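/- Let $\mathcal C=\{(x,y,0): x^2+y^2=1\}\subset\mathbb R^3$ carry a constant mass density $\lambda>0$, and let $$V(\mathbf r)=-\int_{\mathcal C}\frac{\lambda\,du}{\|\mathbf r-u\|},\qquad \mathbf r\in\mathbb R^3\setminus\mathcal C,$$ be the potential that it induces ($du$ is arc length). An orbit of the fixed homogeneous circle problem is a solution $\mathbf r:\mathbb R\to\mathbb R^3\setminus\mathcal C$ of $\ddot{\mathbf r}=-\nabla V(\mathbf r)$; its trace is the set $\{\mathbf r(t):t\in\mathbb R\}$. The horizontal plane is the $xy$-plane, and a vertical plane is a plane that contains the $z$-axis. A simple closed curve in a plane $\Lambda$ encloses a point of $\Lambda$ if the point lies in the bounded component of the complement of the curve in $\Lambda$. **Theorem A.** Let $\Lambda$ be a vertical plane and let $\varepsilon>0$. (i) There is a periodic orbit $\mathbf r(t)$ of the fixed homogeneous circle problem, contained in $\Lambda$, such that $\|\mathbf r(t)\|\ge 1/\varepsilon$ for all $t$, and whose trace is a simple closed curve, symmetric with respect to the horizontal plane and with respect to the $z$-axis, that encloses the origin. (ii) For each of the two points $p$ of $\mathcal C\cap\Lambda$ there is a periodic orbit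 $\mathbf s(t)$ of the fixed homogeneous circle problem, contained in $\Lambda$, such that $\operatorname{dist}(\mathbf s(t),\mathcal C)\le\varepsilon$ for all $t$ (Euclidean distance), and whose trace is a simple closed curve, symmetric with respect to the horizontal plane, that encloses $p$. -/

import Mathlib

noncomputable section

namespace FixedCircle

/-- Euclidean three-space, with coordinates `x = r 0`, `y = r 1`, `z = r 2`. -/
abbrev E3 : Type := EuclideanSpace ℝ (Fin 3)

/-- The arc-length parametrization of the unit circle of the horizontal plane. -/
def circlePoint (θ : ℝ) : E3 := !₂[Real.cos θ, Real.sin θ, 0]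

/-- The circle of radius one in the horizontal plane, centered at the origin. -/
def circle : Set E3 := Set.range circlePoint

/-- The potential of the homogeneous circle with constant mass density `lam`. -/
def potential (lam : ℝ) (r : E3) : ℝ :=
  -∫ θ in (0 : ℝ)..(2 * Real.pi), lam / ‖r - circlePoint θ‖

/-- `r` is an orbit, defined for all times and off the circle, of the equation `r'' = -∇V(r)`. -/
def IsOrbit (lam : ℝ) (r : ℝ → E3) : Prop :=
  (∀ t, r t ∉ circle) ∧
    ∃ v : ℝ → E3, ∀ t, HasDerivAt r (v t) t ∧ HasDerivAt v (-gradient (potential lam) (r t)) t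

/-- A periodic orbit of the fixed homogeneous circle problem. -/
def IsPeriodicOrbit (lam : ℝ) (r : ℝ → E3) : Prop :=
  IsOrbit lam r ∧ ∃ T : ℝ, 0 < T ∧ Function.Periodic r T

/-- A vertical plane: a plane that contains the `z`-axis. -/
def IsVerticalPlane (P : Submodule ℝ E3) : Prop :=
  Module.finrank ℝ P = 2 ∧ EuclideanSpace.single (2 : Fin 3) (1 : ℝ) ∈ P

/-- `S` is a simple closed curve: the image of a closed path without self-intersections. -/
def IsSimpleClosedCurve (S : Set E3) : Prop :=
  ∃ γ : ℝ → E3, Continuous γ ∧ Function.Periodic γ 1 ∧ Set.InjOn γ (Set.Ico 0 1) ∧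
    Set.range γ = S

/-- Reflection in the horizontal plane. -/
def reflHorizontal (r : E3) : E3 := !₂[r 0, r 1, -r 2]

/-- Reflection in the `z`-axis; on a vertical plane it is the reflection of this plane in the
`z`-axis. -/
def reflZAxis (r : E3) : E3 := !₂[-r 0, -r 1, r 2]

/-- `S` encloses the point `p` in the plane `P`: the point is off `S`, and its connected
component in the complement of `S` in `P` is bounded. -/
def Encloses (P : Submodule ℝ E3) (S : Set E3) (p : E3) : Prop :=
  p ∈ (P : Set E3) \ S ∧ Bornology.IsBounded (connectedComponentIn ((P : Set E3) \ S) p)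

end FixedCircle

end

/-!
In a vertical plane, in polar coordinates around the origin or around a point of the circle,
Newton's equation becomes a differential equation for the radius `r`, the radial velocity `p` and
the angular momentum `L` as functions of the polar angle `θ` (`polarFlow`). After a rescaling of
space and time, the attraction of the circle is uniformly close on the annulus `1/2 ≤ r ≤ 2` to a central force: far
from the circle to that of a point mass (`far_estimate`), and near the circle to that of an
attracting line (`near_estimate`). Only closeness of the forces themselves is needed, not of their
derivatives.

Both central forces have a circular orbit, and the orbits near it oscillate in the radius with a
frequency `κ` in the polar angle: `κ = 1` for the inverse square law of the point mass, `κ = √2` for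
the inverse first power law of the line. Let `Θ` be the angle between two half-lines of reflection
symmetry, `π / 2` at the origin and `π` at a point of the circle. An orbit that starts
perpendicularly to the first half-line with angular momentum `1 + δ` has, to first order in `δ`, the
radial velocity `(2 * δ / κ) * sin (κ * Θ)` at the angle `Θ`. As `sin (κ * Θ) ≠ 0` in both cases,
this changes sign with `δ`, and by Grönwall's inequality it still does so for the perturbed force.
Hence some orbit meets the second half-line perpendicularly, and by uniqueness it has both reflection
symmetries and is therefore closed (`exists_symmetric_polarOrbit`). To have solutions up to the angle `Θ`
without a continuation argument, the vector field is clamped to a box of states, which the orbits in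
question turn out not to leave.

As the orbit is a graph `r = r θ > 0` in polar coordinates, its trace is a simple closed curve, and
the points of smaller radius are separated from those of larger radius (`encloses_polarCurve`).
-/

open Set Filter Topology MeasureTheory
open scoped NNReal

namespace FixedCircle

/-! ### Global solutions of Lipschitz differential equations -/

/-- A bounded vector field that is continuous in time and uniformly Lipschitz in space has a
solution through every point that is defined for all times. -/
theorem exists_global_solution {E : Type*} [NormedAddCommGroup E] [NormedSpace ℝ E]
    [CompleteSpace E] {G : ℝ → E → E} {K : ℝ≥0} {M : ℝ}
    (hG : ∀ t, LipschitzWith K (G t)) (hGt : ∀ x, Continuous fun t => G t x)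
    (hM : ∀ t x, ‖G t x‖ ≤ M) (x₀ : E) :
    ∃ X : ℝ → E, X 0 = x₀ ∧ ∀ t, HasDerivAt X (G t (X t)) t := by
  have hM0 : 0 ≤ M := (norm_nonneg _).trans (hM 0 x₀)
  have key : ∀ n : ℕ, ∃ X : ℝ → E, X 0 = x₀ ∧
      ∀ t ∈ Ioo (-(n + 1 : ℝ)) (n + 1), HasDerivAt X (G t (X t)) t := by
    intro n
    have hn : (0 : ℝ) ≤ n + 1 := by positivity
    let t₀ : Icc (-(n + 1 : ℝ)) (n + 1) := ⟨0, neg_nonpos.2 hn, hn⟩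
    have hPL : IsPicardLindelof G t₀ x₀ (M.toNNReal * (n + 1)) 0 M.toNNReal K :=
      { lipschitzOnWith := fun t _ => (hG t).lipschitzOnWith
        continuousOn := fun x _ => (hGt x).continuousOn
        norm_le := fun t _ x _ => by simpa [Real.coe_toNNReal _ hM0] using hM t x
        mul_max_le := by simp [t₀] }
    obtain ⟨X, hX0, hX⟩ := hPL.exists_eq_forall_mem_Icc_hasDerivWithinAt₀
    exact ⟨X, hX0, fun t ht => (hX t (Ioo_subset_Icc_self ht)).hasDerivAt
      (Icc_mem_nhds ht.1 ht.2)⟩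
  choose X hX0 hX using key
  have agree : ∀ m n : ℕ, m ≤ n → EqOn (X m) (X n) (Ioo (-(m + 1 : ℝ)) (m + 1)) := by
    intro m n hmn
    have hmn' : (m : ℝ) ≤ n := by exact_mod_cast hmn
    refine ODE_solution_unique_of_mem_Ioo (v := G) (K := K) (s := fun _ => univ) (t₀ := 0)
      (fun t _ => (hG t).lipschitzOnWith) ⟨by linarith [Nat.cast_nonneg (α := ℝ) m], by positivity⟩
      (fun t ht => ⟨hX m t ht, trivial⟩)
      (fun t ht => ⟨hX n t ⟨by linarith [ht.1], by linarith [ht.2]⟩, trivial⟩) ?_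
    rw [hX0, hX0]
  refine ⟨fun t => X ⌈|t|⌉₊ t, by simpa using hX0 0, fun t => ?_⟩
  have hlt : ∀ s : ℝ, s ∈ Ioo (-((⌈|s|⌉₊ : ℝ) + 1)) (⌈|s|⌉₊ + 1) := by
    intro s
    have := Nat.le_ceil |s|
    have := abs_lt.1 (lt_of_le_of_lt this (lt_add_one _))
    exact this
  refine (hX _ t (hlt t)).congr_of_eventuallyEq ?_
  filter_upwards [Ioo_mem_nhds (hlt t).1 (hlt t).2] with s hs
  rcases le_total ⌈|t|⌉₊ ⌈|s|⌉₊ with h | h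
  · exact (agree _ _ h hs).symm
  · exact agree _ _ h (hlt s)

/-- If an involution carries the equation to its time reversal about `c` and fixes the value of a
solution at `c`, then the solution is symmetric about `c`. -/
theorem solution_reflection {E : Type*} [NormedAddCommGroup E] [NormedSpace ℝ E]
    {G : ℝ → E → E} {K : ℝ≥0} (hG : ∀ t, LipschitzWith K (G t)) (R : E →L[ℝ] E) {c : ℝ}
    (hR : ∀ t x, R (-G (2 * c - t) x) = G t (R x)) {X : ℝ → E}
    (hX : ∀ t, HasDerivAt X (G t (X t)) t) (hc : R (X c) = X c) (t : ℝ) :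
    X (2 * c - t) = R (X t) := by
  have hY : ∀ t, HasDerivAt (fun t => R (X (2 * c - t))) (G t (R (X (2 * c - t)))) t := by
    intro t
    have h1 : HasDerivAt (fun t => X (2 * c - t)) (-G (2 * c - t) (X (2 * c - t))) t := by
      have := (hX (2 * c - t)).scomp t ((hasDerivAt_id t).const_sub (2 * c))
      simpa [Function.comp_def] using this
    rw [← hR]
    exact R.hasFDerivAt.comp_hasDerivAt t h1
  have h := ODE_solution_unique_univ (v := G) (s := fun _ => univ) (K := K) (t₀ := c)
    (fun t => (hG t).lipschitzOnWith) (fun t => ⟨hY t, trivial⟩) (fun t => ⟨hX t, trivial⟩)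
    (by simp only [two_mul, add_sub_cancel_right, hc])
  have := congrFun h (2 * c - t)
  simpa using this.symm

/-! ### The equations of motion in polar coordinates -/

/-- The right-hand side of Newton's equation in polar coordinates, with the polar angle `θ` as
independent variable. The argument is `((r, p, L), (Fr, Ft))`: the radius, the radial velocity, the
angular momentum, and the radial and the transversal component of the force. -/
noncomputable def polarFlow (Z : (ℝ × ℝ × ℝ) × ℝ × ℝ) : ℝ × ℝ × ℝ :=
  (Z.1.2.1 * Z.1.1 ^ 2 / Z.1.2.2,
    Z.1.1 ^ 2 * Z.2.1 / Z.1.2.2 + Z.1.2.2 / Z.1.1,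
    Z.1.1 ^ 3 * Z.2.2 / Z.1.2.2)

/-- A compact box of states `(r, p, L)` around the state `(1, 0, 1)` of the circular orbit. -/
def stateBox : Set (ℝ × ℝ × ℝ) := Icc (1 / 2) 2 ×ˢ Icc (-1) 1 ×ˢ Icc (1 / 2) 2

/-- The box `stateBox`, together with a bound on the force components. -/
def forceBox : Set ((ℝ × ℝ × ℝ) × ℝ × ℝ) := stateBox ×ˢ Icc (-5) 5 ×ˢ Icc (-5) 5

/-- The nearest-point retraction of the line onto `[a, b]`. -/
noncomputable def clamp (a b x : ℝ) : ℝ := max a (min b x)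

/-- The coordinatewise retraction onto `stateBox`. -/
noncomputable def clampState (X : ℝ × ℝ × ℝ) : ℝ × ℝ × ℝ :=
  (clamp (1 / 2) 2 X.1, clamp (-1) 1 X.2.1, clamp (1 / 2) 2 X.2.2)

lemma lipschitzWith_clamp (a b : ℝ) : LipschitzWith 1 (clamp a b) :=
  (LipschitzWith.id.const_min b).const_max a

lemma clamp_mem {a b : ℝ} (h : a ≤ b) (x : ℝ) : clamp a b x ∈ Icc a b :=
  ⟨le_max_left _ _, max_le h (min_le_left _ _)⟩

lemma clamp_of_mem {a b x : ℝ} (h : x ∈ Icc a b) : clamp a b x = x := by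
  rw [clamp, min_eq_right h.2, max_eq_right h.1]

lemma clamp_neg (a x : ℝ) (ha : 0 ≤ a) : clamp (-a) a (-x) = -clamp (-a) a x := by
  unfold clamp
  rcases le_total a x with h | h <;> rcases le_total (-a) x with h' | h' <;>
    simp [max_def, min_def] <;> split_ifs <;> linarith

lemma clampState_mem (X : ℝ × ℝ × ℝ) : clampState X ∈ stateBox :=
  ⟨clamp_mem (by norm_num) _, clamp_mem (by norm_num) _, clamp_mem (by norm_num) _⟩

lemma clampState_of_mem {X : ℝ × ℝ × ℝ} (h : X ∈ stateBox) : clampState X = X := by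
  obtain ⟨h1, h2, h3⟩ := h
  simp only [clampState, clamp_of_mem h1, clamp_of_mem h2, clamp_of_mem h3]

lemma lipschitzWith_clampState : LipschitzWith 1 clampState := by
  have h1 := (lipschitzWith_clamp (1 / 2) 2).comp (LipschitzWith.prod_fst (α := ℝ) (β := ℝ × ℝ))
  have h2 := (lipschitzWith_clamp (-1) 1).comp
    (LipschitzWith.prod_fst.comp (LipschitzWith.prod_snd (α := ℝ) (β := ℝ × ℝ)))
  have h3 := (lipschitzWith_clamp (1 / 2) 2).comp
    (LipschitzWith.prod_snd.comp (LipschitzWith.prod_snd (α := ℝ) (β := ℝ × ℝ)))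
  exact (h1.prodMk (h2.prodMk h3)).weaken (by simp)

lemma isCompact_forceBox : IsCompact forceBox :=
  (isCompact_Icc.prod (isCompact_Icc.prod isCompact_Icc)).prod (isCompact_Icc.prod isCompact_Icc)

lemma contDiffAt_polarFlow {Z : (ℝ × ℝ × ℝ) × ℝ × ℝ} (hZ : Z ∈ forceBox) :
    ContDiffAt ℝ 1 polarFlow Z := by
  obtain ⟨⟨h1, -, h3⟩, -⟩ := hZ
  have h1' : Z.1.1 ≠ 0 := by have := h1.1; positivity
  have h3' : Z.1.2.2 ≠ 0 := by have := h3.1; positivity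
  have e1 : ContDiff ℝ 1 fun Z : (ℝ × ℝ × ℝ) × ℝ × ℝ => Z.1.1 := by fun_prop
  have e2 : ContDiff ℝ 1 fun Z : (ℝ × ℝ × ℝ) × ℝ × ℝ => Z.1.2.1 := by fun_prop
  have e3 : ContDiff ℝ 1 fun Z : (ℝ × ℝ × ℝ) × ℝ × ℝ => Z.1.2.2 := by fun_prop
  have e4 : ContDiff ℝ 1 fun Z : (ℝ × ℝ × ℝ) × ℝ × ℝ => Z.2.1 := by fun_prop
  have e5 : ContDiff ℝ 1 fun Z : (ℝ × ℝ × ℝ) × ℝ × ℝ => Z.2.2 := by fun_prop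
  exact ((e2.mul (e1.pow 2)).contDiffAt.div e3.contDiffAt h3').prodMk
    ((((e1.pow 2).mul e4).contDiffAt.div e3.contDiffAt h3').add
      (e3.contDiffAt.div e1.contDiffAt h1') |>.prodMk
      (((e1.pow 3).mul e5).contDiffAt.div e3.contDiffAt h3'))

lemma exists_lipschitzOnWith_polarFlow : ∃ K, LipschitzOnWith K polarFlow forceBox := by
  refine LocallyLipschitzOn.exists_lipschitzOnWith_of_compact isCompact_forceBox fun Z hZ => ?_
  obtain ⟨K, t, ht, h⟩ := (contDiffAt_polarFlow hZ).exists_lipschitzOnWith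
  exact ⟨K, t, mem_nhdsWithin_of_mem_nhds ht, h⟩

lemma exists_bound_polarFlow : ∃ M, ∀ Z ∈ forceBox, ‖polarFlow Z‖ ≤ M :=
  isCompact_forceBox.exists_bound_of_continuousOn
    fun _ hZ => (contDiffAt_polarFlow hZ).continuousAt.continuousWithinAt

/-- The polar components `Fr r θ` and `Ft r θ` of a force on the annulus `1/2 ≤ r ≤ 2` that is
`η`-close to the central force with radial component `f r`, and is symmetric under the reflections
`θ ↦ -θ` and `θ ↦ 2 * Θ - θ`. -/
structure IsNearRadial (Θ : ℝ) (f : ℝ → ℝ) (η : ℝ) (Fr Ft : ℝ → ℝ → ℝ) : Prop where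
  lipschitz : ∃ K, ∀ θ, LipschitzOnWith K (fun r => Fr r θ) (Icc (1 / 2) 2) ∧
    LipschitzOnWith K (fun r => Ft r θ) (Icc (1 / 2) 2)
  continuous : ∀ r ∈ Icc (1 / 2 : ℝ) 2, Continuous (Fr r) ∧ Continuous (Ft r)
  near : ∀ r ∈ Icc (1 / 2 : ℝ) 2, ∀ θ, |Fr r θ - f r| ≤ η ∧ |Ft r θ| ≤ η
  reflect : ∀ r θ, Fr r (-θ) = Fr r θ ∧ Ft r (-θ) = -Ft r θ
  reflect' : ∀ r θ, Fr r (2 * Θ - θ) = Fr r θ ∧ Ft r (2 * Θ - θ) = -Ft r θ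

/-- The polar vector field of a force, extended from `stateBox` to all states by clamping. -/
noncomputable def clampedField (Fr Ft : ℝ → ℝ → ℝ) (θ : ℝ) (X : ℝ × ℝ × ℝ) : ℝ × ℝ × ℝ :=
  polarFlow (clampState X, Fr (clampState X).1 θ, Ft (clampState X).1 θ)

/-- The reversal of the radial velocity. -/
noncomputable def reverse : ℝ × ℝ × ℝ →L[ℝ] ℝ × ℝ × ℝ :=
  (ContinuousLinearMap.id ℝ ℝ).prodMap
    ((-ContinuousLinearMap.id ℝ ℝ).prodMap (ContinuousLinearMap.id ℝ ℝ))

@[simp] lemma reverse_apply (X : ℝ × ℝ × ℝ) : reverse X = (X.1, -X.2.1, X.2.2) := rfl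

lemma lipschitzWith_clampedField {Fr Ft : ℝ → ℝ → ℝ}
    (hL : ∃ K, ∀ θ, LipschitzOnWith K (fun r => Fr r θ) (Icc (1 / 2) 2) ∧
      LipschitzOnWith K (fun r => Ft r θ) (Icc (1 / 2) 2))
    (hB : ∀ r ∈ Icc (1 / 2 : ℝ) 2, ∀ θ, Fr r θ ∈ Icc (-5) 5 ∧ Ft r θ ∈ Icc (-5) 5) :
    ∃ K, ∀ θ, LipschitzWith K (clampedField Fr Ft θ) := by
  obtain ⟨K₁, hK₁⟩ := exists_lipschitzOnWith_polarFlow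
  obtain ⟨K₂, hK₂⟩ := hL
  refine ⟨K₁ * max 1 (max (K₂ * 1) (K₂ * 1)), fun θ => ?_⟩
  rw [← lipschitzOnWith_univ]
  have hc := lipschitzWith_clampState.lipschitzOnWith (s := univ)
  have hc1 : LipschitzOnWith 1 (fun X => (clampState X).1) univ :=
    ((LipschitzWith.prod_fst.comp lipschitzWith_clampState).weaken (by simp)).lipschitzOnWith
  have hm : MapsTo (fun X => (clampState X).1) univ (Icc (1 / 2) 2) :=
    fun X _ => (clampState_mem X).1
  have h1 := (hK₂ θ).1.comp hc1 hm
  have h2 := (hK₂ θ).2.comp hc1 hm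
  exact hK₁.comp (hc.prodMk (h1.prodMk h2))
    fun X _ => ⟨clampState_mem X, (hB _ (clampState_mem X).1 θ).1, (hB _ (clampState_mem X).1 θ).2⟩

lemma reverse_clampedField {Fr Ft : ℝ → ℝ → ℝ} {c : ℝ}
    (h : ∀ r θ, Fr r (2 * c - θ) = Fr r θ ∧ Ft r (2 * c - θ) = -Ft r θ) (θ : ℝ) (X : ℝ × ℝ × ℝ) :
    reverse (-clampedField Fr Ft (2 * c - θ) X) = clampedField Fr Ft θ (reverse X) := by
  have hs : clampState (reverse X) = reverse (clampState X) := by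
    simp [clampState, clamp_neg]
  simp only [clampedField, hs, polarFlow, (h _ _).1, (h _ _).2]
  ext <;> simp <;> ring

/-! ### Orbits near the circular orbit -/

/-- The first-order approximation of the orbit with angular momentum `1 + δ` satisfies the
unperturbed equations up to a term of order `δ ^ 2`. -/
lemma dist_polarFlow_le {n : ℕ} (hn : n ≤ 1) {δ x y : ℝ} (hδ : |δ| ≤ 1 / 20)
    (hx : |x| ≤ 4 * |δ|) (hy : |y| ≤ 2 * |δ|) :
    dist (y, 2 * δ - (n + 1) * x, (0 : ℝ))
      (polarFlow ((1 + x, y, 1 + δ), -((1 + x) ^ n / (1 + x) ^ 2), 0)) ≤ 50 * δ ^ 2 := by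
  have hd := abs_le.1 hδ
  have hx' := abs_le.1 (hx.trans (by linarith : 4 * |δ| ≤ 1 / 5))
  have hp : 0 < 1 + δ := by linarith
  have hq : 0 < 1 + x := by linarith
  have hδ2 : |δ| ^ 2 = δ ^ 2 := sq_abs δ
  have hd0 := abs_nonneg δ
  have hdiv : ∀ a b : ℝ, 19 / 20 ≤ b → |a / b| ≤ 2 * |a| := by
    intro a b hb
    rw [abs_div, abs_of_pos (by linarith : 0 < b), div_le_iff₀ (by linarith)]
    nlinarith [abs_nonneg a]
  have hxx : |x ^ 2| ≤ 16 * δ ^ 2 := by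
    rw [abs_pow]; nlinarith [abs_nonneg x]
  have hdx : |δ * x| ≤ 4 * δ ^ 2 := by
    rw [abs_mul]; nlinarith
  have hq2 : |(1 + δ) * (x ^ 2 / (1 + x))| ≤ 25 * δ ^ 2 := by
    rw [abs_mul, abs_div, abs_of_pos hp, abs_of_pos hq]
    have : |x ^ 2| / (1 + x) ≤ 16 * δ ^ 2 / (4 / 5) := by gcongr; linarith
    have h3 : (1 + δ) * (|x ^ 2| / (1 + x)) ≤ 21 / 20 * (16 * δ ^ 2 / (4 / 5)) := by
      gcongr; linarith
    nlinarith [sq_nonneg δ]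
  have hdd : |δ ^ 2 / (1 + δ)| ≤ 2 * δ ^ 2 := by
    have := hdiv (δ ^ 2) (1 + δ) (by linarith)
    rwa [abs_of_nonneg (sq_nonneg δ)] at this
  rw [Prod.dist_eq, Prod.dist_eq]
  refine max_le ?_ (max_le ?_ ?_)
  · have e : y - y * (1 + x) ^ 2 / (1 + δ) = y * (δ - 2 * x - x ^ 2) / (1 + δ) := by
      field_simp; ring
    simp only [polarFlow, Real.dist_eq, e]
    refine (hdiv _ _ (by linarith)).trans ?_
    rw [abs_mul]
    have h1 : |δ - 2 * x - x ^ 2| ≤ 10 * |δ| := by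
      have a1 := abs_sub (δ - 2 * x) (x ^ 2)
      have a2 := abs_sub δ (2 * x)
      rw [abs_mul, abs_two] at a2
      nlinarith
    have := mul_le_mul hy h1 (abs_nonneg _) (by positivity)
    nlinarith
  · have hsplit : (2 * δ - (n + 1) * x) -
        ((1 + x) ^ 2 * -((1 + x) ^ n / (1 + x) ^ 2) / (1 + δ) + (1 + δ) / (1 + x)) =
        (1 - n) * (δ * x) + (1 + n * x) * (δ ^ 2 / (1 + δ)) - (1 + δ) * (x ^ 2 / (1 + x)) := by
      interval_cases n
      · field_simp; push_cast; ring
      · field_simp; push_cast; ring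
    simp only [polarFlow, Real.dist_eq, hsplit]
    have hn0 : (0 : ℝ) ≤ n := Nat.cast_nonneg n
    have hn1 : (n : ℝ) ≤ 1 := by exact_mod_cast hn
    have b1 : |(1 - n : ℝ) * (δ * x)| ≤ 4 * δ ^ 2 := by
      rw [abs_mul]
      have : |(1 - n : ℝ)| ≤ 1 := abs_le.2 ⟨by linarith, by linarith⟩
      nlinarith [abs_nonneg (δ * x)]
    have b2 : |(1 + n * x) * (δ ^ 2 / (1 + δ))| ≤ 4 * δ ^ 2 := by
      rw [abs_mul]
      have : |(1 + n * x)| ≤ 2 := abs_le.2 ⟨by nlinarith, by nlinarith⟩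
      nlinarith [abs_nonneg (δ ^ 2 / (1 + δ))]
    have a1 := abs_sub ((1 - n) * (δ * x) + (1 + n * x) * (δ ^ 2 / (1 + δ)))
      ((1 + δ) * (x ^ 2 / (1 + x)))
    have a2 := abs_add_le ((1 - n) * (δ * x)) ((1 + n * x) * (δ ^ 2 / (1 + δ)))
    nlinarith [sq_nonneg δ]
  · simp [polarFlow]; positivity

lemma exists_gronwallBound_le (K : ℝ≥0) (T : ℝ) :
    ∃ C > 0, ∀ e ≥ 0, ∀ t ∈ Icc 0 T, gronwallBound 0 K e t ≤ C * e := by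
  have hlin : ∀ e, gronwallBound 0 K e T = gronwallBound 0 K 1 T * e := by
    intro e
    by_cases hK : (K : ℝ) = 0
    · simp [hK, gronwallBound_K0, mul_comm]
    · simp only [gronwallBound_of_K_ne_0 hK]; ring
  refine ⟨max (gronwallBound 0 K 1 T) 1, by positivity, fun e he t ht => ?_⟩
  refine (gronwallBound_mono le_rfl he K.coe_nonneg ht.2).trans ?_
  rw [hlin e]
  exact mul_le_mul_of_nonneg_right (le_max_left _ _) he

/-- The functions `(r, p, L)` of the polar angle solve the polar equations of motion for the force
with components `Fr`, `Ft`, and stay in `stateBox`. -/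
structure IsPolarOrbit (Fr Ft : ℝ → ℝ → ℝ) (r p L : ℝ → ℝ) : Prop where
  mem : ∀ θ, (r θ, p θ, L θ) ∈ stateBox
  deriv_r : ∀ θ, HasDerivAt r (p θ * r θ ^ 2 / L θ) θ
  deriv_p : ∀ θ, HasDerivAt p (r θ ^ 2 * Fr (r θ) θ / L θ + L θ / r θ) θ
  deriv_L : ∀ θ, HasDerivAt L (r θ ^ 3 * Ft (r θ) θ / L θ) θ

/-- The first-order approximation in `δ` of the unperturbed orbit that starts at distance one with
transversal velocity `1 + δ`; here `κ` is the radial frequency. -/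
noncomputable def approxOrbit (κ δ θ : ℝ) : ℝ × ℝ × ℝ :=
  (1 + 2 * δ / κ ^ 2 * (1 - Real.cos (κ * θ)), 2 * δ / κ * Real.sin (κ * θ), 1 + δ)

lemma hasDerivAt_approxOrbit {κ : ℝ} (hκ : κ ≠ 0) (δ θ : ℝ) :
    HasDerivAt (approxOrbit κ δ) ((approxOrbit κ δ θ).2.1,
      2 * δ - κ ^ 2 * (2 * δ / κ ^ 2 * (1 - Real.cos (κ * θ))), 0) θ := by
  have hκθ : HasDerivAt (fun θ => κ * θ) κ θ := by simpa using (hasDerivAt_id θ).const_mul κ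
  have h1 := ((hκθ.cos.const_sub 1).const_mul (2 * δ / κ ^ 2)).const_add 1
  have h2 := hκθ.sin.const_mul (2 * δ / κ)
  have h3 := hasDerivAt_const θ (1 + δ)
  refine (h1.prodMk (h2.prodMk h3)).congr_deriv ?_
  simp only [approxOrbit, Prod.mk.injEq, and_true]
  constructor <;> field_simp
  ring

lemma approxOrbit_bounds {κ : ℝ} (hκ : 1 ≤ κ) (δ θ : ℝ) :
    |2 * δ / κ ^ 2 * (1 - Real.cos (κ * θ))| ≤ 4 * |δ| ∧
      |2 * δ / κ * Real.sin (κ * θ)| ≤ 2 * |δ| := by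
  have hκ0 : 0 < κ := by linarith
  have hκ2 : 1 ≤ κ ^ 2 := one_le_pow₀ hκ
  have hd := abs_nonneg δ
  constructor
  · rw [abs_mul, abs_div, abs_mul, abs_two, abs_of_pos (by positivity : 0 < κ ^ 2)]
    have h1 : 2 * |δ| / κ ^ 2 ≤ 2 * |δ| := div_le_self (by positivity) hκ2
    have h2 : |1 - Real.cos (κ * θ)| ≤ 2 := abs_le.2
      ⟨by linarith [Real.cos_le_one (κ * θ)], by linarith [Real.neg_one_le_cos (κ * θ)]⟩
    have := mul_le_mul h1 h2 (abs_nonneg _) (by positivity)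
    linarith
  · rw [abs_mul, abs_div, abs_mul, abs_two, abs_of_pos hκ0]
    have h1 : 2 * |δ| / κ ≤ 2 * |δ| := div_le_self (by positivity) hκ
    have := mul_le_mul h1 (Real.abs_sin_le_one (κ * θ)) (abs_nonneg _) (by positivity)
    linarith

lemma lipschitzOnWith_radial (n : ℕ) :
    ∃ K, LipschitzOnWith K (fun r : ℝ => -(r ^ n / r ^ 2)) (Icc (1 / 2) 2) := by
  refine LocallyLipschitzOn.exists_lipschitzOnWith_of_compact isCompact_Icc fun r hr => ?_
  have hr0 : r ≠ 0 := by have := hr.1; positivity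
  have : ContDiffAt ℝ 1 (fun r : ℝ => -(r ^ n / r ^ 2)) r := by
    refine (ContDiffAt.div ?_ ?_ (by positivity)).neg <;> fun_prop
  obtain ⟨K, t, ht, h⟩ := this.exists_lipschitzOnWith
  exact ⟨K, t, mem_nhdsWithin_of_mem_nhds ht, h⟩

lemma radial_bounds {n : ℕ} (hn : n ≤ 1) {r : ℝ} (hr : r ∈ Icc (1 / 2 : ℝ) 2) :
    |-(r ^ n / r ^ 2)| ≤ 4 := by
  obtain ⟨h1, h2⟩ := hr
  rw [abs_neg, abs_of_nonneg (by positivity), div_le_iff₀ (by positivity)]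
  interval_cases n <;> nlinarith

/-- On `[0, Θ]`, the orbits of a nearly radial force that start at distance one with transversal
velocity near one are close to their first-order approximations. -/
lemma exists_dist_approxOrbit_le {n : ℕ} (hn : n ≤ 1) {κ : ℝ} (hκ : 1 ≤ κ)
    (hκn : κ ^ 2 = n + 1) (Θ : ℝ) :
    ∃ C > 0, ∀ η ∈ Icc (0 : ℝ) 1, ∀ Fr Ft, IsNearRadial Θ (fun r => -(r ^ n / r ^ 2)) η Fr Ft →
      ∀ δ X, |δ| ≤ 1 / 20 → X 0 = (1, 0, 1 + δ) →
        (∀ θ, HasDerivAt X (clampedField Fr Ft θ (X θ)) θ) →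
        ∀ θ ∈ Icc 0 Θ, dist (X θ) (approxOrbit κ δ θ) ≤ C * (δ ^ 2 + η) := by
  obtain ⟨K₀, hK₀⟩ := exists_lipschitzOnWith_polarFlow
  obtain ⟨K₁, hK₁⟩ : ∃ K, ∀ θ, LipschitzWith K
      (clampedField (fun r _ => -(r ^ n / r ^ 2)) (fun _ _ => 0) θ) := by
    obtain ⟨K, hK⟩ := lipschitzOnWith_radial n
    refine lipschitzWith_clampedField
      ⟨K, fun θ => ⟨hK, (LipschitzWith.const _).lipschitzOnWith.weaken zero_le⟩⟩
      fun r hr θ => ⟨?_, by simp⟩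
    have := abs_le.1 (radial_bounds hn hr)
    exact ⟨by linarith, by linarith⟩
  obtain ⟨C, hC, hgr⟩ := exists_gronwallBound_le K₁ Θ
  refine ⟨C * (K₀ + 50), by positivity, fun η hη Fr Ft hF δ X hδ hX0 hX θ hθ => ?_⟩
  have hκ0 : κ ≠ 0 := by positivity
  have hperturb : ∀ θ x, dist (clampedField Fr Ft θ x)
      (clampedField (fun r _ => -(r ^ n / r ^ 2)) (fun _ _ => 0) θ x) ≤ K₀ * η := by
    intro θ x
    have hm := clampState_mem x
    obtain ⟨h1, h2⟩ := hF.near _ hm.1 θ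
    have h3 := abs_le.1 (radial_bounds hn hm.1)
    have h1' := abs_le.1 h1
    have h2' := abs_le.1 h2
    have h4 := hη.2
    refine (hK₀.dist_le_mul _ ⟨hm, ⟨?_, ?_⟩, ⟨?_, ?_⟩⟩ _ ⟨hm, ⟨?_, ?_⟩, by simp⟩).trans ?_
    all_goals try (simp only; linarith)
    refine mul_le_mul_of_nonneg_left ?_ K₀.coe_nonneg
    rw [Prod.dist_eq, Prod.dist_eq]
    refine max_le (by simpa using hη.1) (max_le (by simpa [Real.dist_eq] using h1) ?_)
    simpa [Real.dist_eq] using h2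
  have hmem : ∀ θ, approxOrbit κ δ θ ∈ stateBox := by
    intro θ
    obtain ⟨h1, h2⟩ := approxOrbit_bounds hκ δ θ
    have h1' := abs_le.1 h1
    have h2' := abs_le.1 h2
    have h3' := abs_le.1 hδ
    refine ⟨⟨?_, ?_⟩, ⟨?_, ?_⟩, ⟨?_, ?_⟩⟩ <;> simp only [approxOrbit] <;> linarith
  have hdef : ∀ θ, dist ((approxOrbit κ δ θ).2.1,
      2 * δ - κ ^ 2 * (2 * δ / κ ^ 2 * (1 - Real.cos (κ * θ))), (0 : ℝ))
      (clampedField (fun r _ => -(r ^ n / r ^ 2)) (fun _ _ => 0) θ (approxOrbit κ δ θ))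
      ≤ 50 * δ ^ 2 := by
    intro θ
    obtain ⟨h1, h2⟩ := approxOrbit_bounds hκ δ θ
    rw [clampedField, clampState_of_mem (hmem θ), hκn]
    rw [hκn] at h1
    simp only [approxOrbit, hκn]
    exact dist_polarFlow_le hn hδ h1 h2
  have h := dist_le_of_approx_trajectories_ODE (a := 0) (b := Θ) (δ := 0) hK₁
    (f := X) (g := approxOrbit κ δ)
    (fun t _ => (hX t).continuousAt.continuousWithinAt)
    (fun t _ => (hX t).hasDerivWithinAt) (fun t _ => hperturb t (X t))
    (fun t _ => (hasDerivAt_approxOrbit hκ0 δ t).continuousAt.continuousWithinAt)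
    (fun t _ => (hasDerivAt_approxOrbit hκ0 δ t).hasDerivWithinAt) (fun t _ => hdef t)
    (by simp [hX0, approxOrbit]) θ hθ
  rw [sub_zero] at h
  have hη0 := hη.1
  refine h.trans ((hgr _ (by positivity) θ hθ).trans ?_)
  rw [mul_assoc]
  gcongr
  nlinarith [K₀.coe_nonneg, sq_nonneg δ, mul_nonneg K₀.coe_nonneg (sq_nonneg δ)]

/-- A nearly radial force whose radial frequency `κ` satisfies `sin (κ * Θ) ≠ 0` has an orbit that
is symmetric under the reflections `θ ↦ -θ` and `θ ↦ 2 * Θ - θ`. It is found by shooting: the radial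
velocity at the angle `Θ` changes sign as the initial velocity passes through one. -/
theorem exists_symmetric_polarOrbit {n : ℕ} (hn : n ≤ 1) {κ Θ : ℝ} (hκ : 1 ≤ κ)
    (hκn : κ ^ 2 = n + 1) (hΘ : 0 < Θ) (hsin : Real.sin (κ * Θ) ≠ 0) :
    ∃ η > 0, ∀ Fr Ft, IsNearRadial Θ (fun r => -(r ^ n / r ^ 2)) η Fr Ft →
      ∃ r p L, IsPolarOrbit Fr Ft r p L ∧
        ∀ θ, (r (-θ) = r θ ∧ L (-θ) = L θ) ∧ r (2 * Θ - θ) = r θ ∧ L (2 * Θ - θ) = L θ := by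
  obtain ⟨C, hC, happrox⟩ := exists_dist_approxOrbit_le hn hκ hκn Θ
  have hκ0 : 0 < κ := by linarith
  -- `s * δ` is the radial velocity at `Θ` of the first-order approximation, up to sign.
  set s := 2 * |Real.sin (κ * Θ)| / κ with hs
  have hs0 : 0 < s := by positivity
  have hs2 : s ≤ 2 := by
    rw [hs, div_le_iff₀ hκ0]; linarith [Real.abs_sin_le_one (κ * Θ)]
  obtain ⟨δ, hδ0, hδ1, hδ2⟩ : ∃ δ > 0, δ ≤ 1 / 20 ∧ C * δ ≤ s / 4 :=
    ⟨min (1 / 20) (s / (4 * C)), by positivity, min_le_left _ _, by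
      calc C * min (1 / 20) (s / (4 * C)) ≤ C * (s / (4 * C)) := by gcongr; exact min_le_right _ _
        _ = s / 4 := by field_simp⟩
  obtain ⟨η, hη0, hη1, hη2⟩ : ∃ η > 0, η ≤ 1 ∧ C * η ≤ s * δ / 8 :=
    ⟨min 1 (s * δ / (8 * C)), by positivity, min_le_left _ _, by
      calc C * min 1 (s * δ / (8 * C)) ≤ C * (s * δ / (8 * C)) := by gcongr; exact min_le_right _ _
        _ = s * δ / 8 := by field_simp⟩
  refine ⟨η, hη0, fun Fr Ft hF => ?_⟩
  have hbd : ∀ r ∈ Icc (1 / 2 : ℝ) 2, ∀ θ, Fr r θ ∈ Icc (-5) 5 ∧ Ft r θ ∈ Icc (-5) 5 := by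
    intro r hr θ
    obtain ⟨h1, h2⟩ := hF.near r hr θ
    have h1 := abs_le.1 h1
    have h2 := abs_le.1 h2
    have h3 := abs_le.1 (radial_bounds hn hr)
    exact ⟨⟨by linarith, by linarith⟩, ⟨by linarith, by linarith⟩⟩
  obtain ⟨K, hK⟩ := lipschitzWith_clampedField hF.lipschitz hbd
  obtain ⟨M, hM⟩ := exists_bound_polarFlow
  have hsol : ∀ δ' : ℝ, ∃ X : ℝ → ℝ × ℝ × ℝ, X 0 = (1, 0, 1 + δ') ∧
      ∀ θ, HasDerivAt X (clampedField Fr Ft θ (X θ)) θ := by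
    intro δ'
    refine exists_global_solution (M := M) hK (fun x => ?_) (fun θ x => ?_) _
    · obtain ⟨h1, h2⟩ := hF.continuous _ (clampState_mem x).1
      simp only [clampedField, polarFlow, div_eq_mul_inv]
      fun_prop
    · exact hM _ ⟨clampState_mem x, hbd _ (clampState_mem x).1 θ⟩
  choose X hX0 hX using hsol
  have hcont : Continuous fun δ' => (X δ' Θ).2.1 := by
    have hLip : LipschitzWith (Real.exp (K * Θ)).toNNReal fun δ' => X δ' Θ := by
      refine LipschitzWith.of_dist_le_mul fun a b => ?_
      have h := dist_le_of_trajectories_ODE (a := 0) (b := Θ) hK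
        (f := X a) (g := X b) (δ := dist a b)
        (fun t _ => (hX a t).continuousAt.continuousWithinAt)
        (fun t _ => (hX a t).hasDerivWithinAt)
        (fun t _ => (hX b t).continuousAt.continuousWithinAt)
        (fun t _ => (hX b t).hasDerivWithinAt)
        (by simp [hX0, Prod.dist_eq]) Θ ⟨hΘ.le, le_rfl⟩
      rw [sub_zero] at h
      rwa [Real.coe_toNNReal _ (Real.exp_pos _).le, mul_comm]
    exact (continuous_fst.comp continuous_snd).comp hLip.continuous
  have hclose : ∀ δ', |δ'| ≤ δ → ∀ θ ∈ Icc 0 Θ,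
      dist (X δ' θ) (approxOrbit κ δ' θ) ≤ s * δ / 2 := by
    intro δ' hδ' θ hθ
    refine (happrox η ⟨hη0.le, hη1⟩ Fr Ft hF δ' (X δ') (hδ'.trans hδ1) (hX0 _) (hX _) θ hθ).trans ?_
    have h1 : δ' ^ 2 ≤ δ ^ 2 := sq_le_sq' (by linarith [(abs_le.1 hδ').1]) (abs_le.1 hδ').2
    have h2 : C * δ' ^ 2 ≤ C * δ ^ 2 := by gcongr
    nlinarith
  have hp : ∀ δ', |δ'| ≤ δ →
      |(X δ' Θ).2.1 - 2 * δ' / κ * Real.sin (κ * Θ)| ≤ s * δ / 2 := by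
    intro δ' hδ'
    have h := hclose δ' hδ' Θ ⟨hΘ.le, le_rfl⟩
    rw [Prod.dist_eq, Prod.dist_eq] at h
    exact ((le_max_left _ _).trans (le_max_right _ _)).trans h
  obtain ⟨δ', hδ', hzero⟩ : ∃ δ', |δ'| ≤ δ ∧ (X δ' Θ).2.1 = 0 := by
    have h1 := abs_le.1 (hp δ (by rw [abs_of_pos hδ0]))
    have h2 := abs_le.1 (hp (-δ) (by rw [abs_neg, abs_of_pos hδ0]))
    have hsδ : 0 < s * δ := by positivity
    have h0 : (0 : ℝ) ∈ uIcc ((X (-δ) Θ).2.1) ((X δ Θ).2.1) := by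
      rw [mem_uIcc]
      rcases lt_or_gt_of_ne hsin with h | h
      · have e1 : 2 * δ / κ * Real.sin (κ * Θ) = -(s * δ) := by
          rw [hs, abs_of_neg h]; ring
        have e2 : 2 * -δ / κ * Real.sin (κ * Θ) = s * δ := by
          rw [hs, abs_of_neg h]; ring
        right; constructor <;> linarith
      · have e1 : 2 * δ / κ * Real.sin (κ * Θ) = s * δ := by
          rw [hs, abs_of_pos h]; ring
        have e2 : 2 * -δ / κ * Real.sin (κ * Θ) = -(s * δ) := by
          rw [hs, abs_of_pos h]; ring
        left; constructor <;> linarith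
    obtain ⟨d, hd, hd0⟩ := intermediate_value_uIcc hcont.continuousOn h0
    rw [uIcc_of_le (by linarith)] at hd
    exact ⟨d, abs_le.2 hd, hd0⟩
  have hsym0 : ∀ θ, X δ' (-θ) = reverse (X δ' θ) := by
    intro θ
    have := solution_reflection (c := 0) hK reverse
      (reverse_clampedField (fun r θ => by simpa using hF.reflect r θ)) (hX δ') (by simp [hX0]) θ
    simpa using this
  have hsymΘ : ∀ θ, X δ' (2 * Θ - θ) = reverse (X δ' θ) := fun θ =>
    solution_reflection hK reverse (reverse_clampedField hF.reflect') (hX δ')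
      (by ext <;> simp [hzero]) θ
  -- On `[0, Θ]` the orbit stays away from the boundary of the box, so clamping has no effect.
  have hmem0 : ∀ θ ∈ Icc 0 Θ, X δ' θ ∈ stateBox := by
    intro θ hθ
    have h := hclose δ' hδ' θ hθ
    rw [Prod.dist_eq, Prod.dist_eq, max_le_iff, max_le_iff] at h
    simp only [approxOrbit, Real.dist_eq] at h
    obtain ⟨h1, h2, h3⟩ := h
    obtain ⟨h4, h5⟩ := approxOrbit_bounds hκ δ' θ
    have h1 := abs_le.1 h1
    have h2 := abs_le.1 h2
    have h3 := abs_le.1 h3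
    have h4 := abs_le.1 h4
    have h5 := abs_le.1 h5
    have h6 := abs_le.1 hδ'
    have h7 : s * δ ≤ 2 * δ := by gcongr
    refine ⟨⟨?_, ?_⟩, ⟨?_, ?_⟩, ⟨?_, ?_⟩⟩ <;> linarith
  have hrev : ∀ x ∈ stateBox, reverse x ∈ stateBox := by
    rintro x ⟨h1, h2, h3⟩
    exact ⟨h1, ⟨by simpa using h2.2, by have := h2.1; simp; linarith⟩, h3⟩
  have hper : Function.Periodic (X δ') (2 * Θ) := by
    intro θ
    rw [show θ + 2 * Θ = 2 * Θ - -θ by ring, hsymΘ, hsym0]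
    ext <;> simp
  have hmem : ∀ θ, X δ' θ ∈ stateBox := by
    intro θ
    obtain ⟨φ, hφ, he⟩ := hper.exists_mem_Ico₀ (by positivity) θ
    rw [he]
    rcases le_total φ Θ with h | h
    · exact hmem0 φ ⟨hφ.1, h⟩
    · rw [show φ = 2 * Θ - (2 * Θ - φ) by ring, hsymΘ]
      exact hrev _ (hmem0 _ ⟨by linarith [hφ.2], by linarith⟩)
  have hX' : ∀ θ, HasDerivAt (X δ')
      (polarFlow (X δ' θ, Fr (X δ' θ).1 θ, Ft (X δ' θ).1 θ)) θ := by
    intro θ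
    have := hX δ' θ
    rwa [clampedField, clampState_of_mem (hmem θ)] at this
  refine ⟨fun θ => (X δ' θ).1, fun θ => (X δ' θ).2.1, fun θ => (X δ' θ).2.2,
    ⟨hmem, fun θ => (hX' θ).fst, fun θ => (hX' θ).snd.fst, fun θ => (hX' θ).snd.snd⟩,
    fun θ => ⟨by simp [hsym0], by simp [hsymΘ]⟩⟩

/-! ### The gradient of the potential -/

lemma continuous_circlePoint : Continuous circlePoint := by
  unfold circlePoint
  refine (PiLp.continuous_toLp 2 _).comp ?_
  refine continuous_pi fun i => ?_
  fin_cases i <;> simp <;> fun_prop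

lemma circlePoint_mem (θ : ℝ) : circlePoint θ ∈ circle := ⟨θ, rfl⟩

lemma circlePoint_periodic : Function.Periodic circlePoint (2 * Real.pi) := by
  intro θ
  simp [circlePoint]

lemma isClosed_circle : IsClosed circle := by
  have h : circle = circlePoint '' Icc 0 (2 * Real.pi) := by
    rw [circle, ← circlePoint_periodic.image_Icc Real.two_pi_pos 0, zero_add]
  rw [h]
  exact (isCompact_Icc.image continuous_circlePoint).isClosed

/-- Newton's law of attraction of the points of the circle, integrated over the circle. -/
lemma hasGradientAt_potential (lam : ℝ) {x : E3} (hx : x ∉ circle) :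
    HasGradientAt (potential lam)
      (∫ θ in (0 : ℝ)..(2 * Real.pi), (lam / ‖x - circlePoint θ‖ ^ 3) • (x - circlePoint θ)) x := by
  obtain ⟨d, hd, hball⟩ := Metric.isOpen_iff.1 isClosed_circle.isOpen_compl x hx
  have hfar : ∀ y ∈ Metric.ball x (d / 2), ∀ θ, d / 2 ≤ ‖y - circlePoint θ‖ := by
    intro y hy θ
    by_contra! h
    refine hball ?_ (circlePoint_mem θ)
    rw [Metric.mem_ball, dist_comm]
    rw [← dist_eq_norm] at h
    linarith [dist_triangle x y (circlePoint θ), dist_comm x y, Metric.mem_ball.1 hy]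
  have hx0 : x ∈ Metric.ball x (d / 2) := Metric.mem_ball_self (by positivity)
  have hderiv : ∀ θ, ∀ y ∈ Metric.ball x (d / 2),
      HasFDerivAt (fun y : E3 => -(lam / ‖y - circlePoint θ‖))
        ((lam / ‖y - circlePoint θ‖ ^ 3) • innerSL ℝ (y - circlePoint θ)) y := by
    intro θ y hy
    have hpos : 0 < ‖y - circlePoint θ‖ := lt_of_lt_of_le (by positivity) (hfar y hy θ)
    have h1 : HasFDerivAt (fun y : E3 => y - circlePoint θ) (ContinuousLinearMap.id ℝ E3) y :=
      (hasFDerivAt_id y).sub_const _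
    have h2 := h1.norm_sq.sqrt (by positivity)
    simp only [Real.sqrt_sq (norm_nonneg _)] at h2
    have h3 := ((hasDerivAt_inv hpos.ne').comp_hasFDerivAt y h2).const_mul (-lam)
    refine (h3.congr_fderiv ?_).congr_of_eventuallyEq (.of_forall fun z => ?_)
    · ext v
      simp
      field_simp
    · simp; ring
  have hcont : ∀ y ∈ Metric.ball x (d / 2), Continuous fun θ => -(lam / ‖y - circlePoint θ‖) := by
    intro y hy
    have hne : ∀ θ, ‖y - circlePoint θ‖ ≠ 0 :=
      fun θ => (lt_of_lt_of_le (by positivity) (hfar y hy θ)).ne'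
    have := continuous_circlePoint
    fun_prop (disch := assumption)
  have hne : ∀ θ, ‖x - circlePoint θ‖ ^ 3 ≠ 0 :=
    fun θ => pow_ne_zero _ (lt_of_lt_of_le (by positivity) (hfar x hx0 θ)).ne'
  have hcont' : Continuous fun θ => (lam / ‖x - circlePoint θ‖ ^ 3) • (x - circlePoint θ) := by
    have := continuous_circlePoint
    fun_prop (disch := assumption)
  have hcont2 : Continuous fun θ =>
      (lam / ‖x - circlePoint θ‖ ^ 3) • innerSL ℝ (x - circlePoint θ) := by
    have := continuous_circlePoint
    fun_prop (disch := assumption)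
  have key := intervalIntegral.hasFDerivAt_integral_of_dominated_of_fderiv_le
    (𝕜 := ℝ) (μ := volume) (a := 0) (b := 2 * Real.pi)
    (F := fun (y : E3) θ => -(lam / ‖y - circlePoint θ‖))
    (F' := fun (y : E3) θ => (lam / ‖y - circlePoint θ‖ ^ 3) • innerSL ℝ (y - circlePoint θ))
    (x₀ := x) (bound := fun _ => |lam| / (d / 2) ^ 2)
    (Metric.ball_mem_nhds x (by positivity))
    (by filter_upwards [Metric.ball_mem_nhds x (by positivity : 0 < d / 2)] with y hy
        exact (hcont y hy).aestronglyMeasurable)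
    ((hcont x hx0).intervalIntegrable _ _) hcont2.aestronglyMeasurable
    (.of_forall fun θ _ y hy => by
      have h1 := hfar y hy θ
      have hpos : 0 < ‖y - circlePoint θ‖ := lt_of_lt_of_le (by positivity) h1
      rw [norm_smul, innerSL_apply_norm, norm_div, Real.norm_eq_abs, norm_pow, norm_norm]
      calc |lam| / ‖y - circlePoint θ‖ ^ 3 * ‖y - circlePoint θ‖
          = |lam| / ‖y - circlePoint θ‖ ^ 2 := by field_simp
        _ ≤ |lam| / (d / 2) ^ 2 := by gcongr)
    intervalIntegrable_const (.of_forall fun θ _ y hy => hderiv θ y hy)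
  rw [hasGradientAt_iff_hasFDerivAt]
  refine (key.congr_fderiv ?_).congr_of_eventuallyEq (.of_forall fun y => ?_)
  · have := (InnerProductSpace.toDual ℝ E3).toContinuousLinearEquiv.toContinuousLinearMap
      |>.intervalIntegral_comp_comm (hcont'.intervalIntegrable 0 (2 * Real.pi) (μ := volume))
    refine Eq.trans ?_ this
    refine intervalIntegral.integral_congr fun θ _ => ?_
    ext v
    simp
  · simp [potential]

/-- The point of the vertical plane through `circlePoint α` with horizontal coordinate `x` and
height `z`. -/
noncomputable def planePoint (α x z : ℝ) : E3 :=
  x • circlePoint α + z • EuclideanSpace.single (2 : Fin 3) (1 : ℝ)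

lemma planePoint_eq (α x z : ℝ) : planePoint α x z = !₂[x * Real.cos α, x * Real.sin α, z] := by
  ext i
  fin_cases i <;> simp [planePoint, circlePoint]

/-- The squared distance of the point `(x, 0, z)` from the point of the circle at the angle `φ`. -/
noncomputable def distSq (x z φ : ℝ) : ℝ := x ^ 2 + z ^ 2 + 1 - 2 * x * Real.cos φ

/-- The integral of the inverse cubed distance of `(x, 0, z)` from the points of the circle. -/
noncomputable def invCube (x z : ℝ) : ℝ :=
  ∫ φ in (-Real.pi)..Real.pi, (√(distSq x z φ) ^ 3)⁻¹

/-- The integral of `invCube`, weighted by the cosine. -/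
noncomputable def invCubeCos (x z : ℝ) : ℝ :=
  ∫ φ in (-Real.pi)..Real.pi, Real.cos φ * (√(distSq x z φ) ^ 3)⁻¹

lemma norm_planePoint_sub (α x z φ : ℝ) :
    ‖planePoint α x z - circlePoint (φ + α)‖ = √(distSq x z φ) := by
  rw [EuclideanSpace.norm_eq, Fin.sum_univ_three]
  congr 1
  simp [planePoint_eq, circlePoint, distSq, Real.cos_add, Real.sin_add]
  have h1 := Real.sin_sq_add_cos_sq α
  have h2 := Real.sin_sq_add_cos_sq φ
  linear_combination (x ^ 2 + Real.cos φ ^ 2 + Real.sin φ ^ 2 - 2 * x * Real.cos φ) * h1 + h2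

lemma distSq_pos {α x z : ℝ} (h : planePoint α x z ∉ circle) (φ : ℝ) : 0 < distSq x z φ := by
  by_contra! h0
  have h1 := norm_planePoint_sub α x z φ
  rw [Real.sqrt_eq_zero_of_nonpos h0, norm_eq_zero, sub_eq_zero] at h1
  exact h (h1 ▸ circlePoint_mem _)

lemma continuous_distSq (x z : ℝ) : Continuous (distSq x z) := by
  unfold distSq; fun_prop

lemma gradient_potential_planePoint (lam : ℝ) {α x z : ℝ} (h : planePoint α x z ∉ circle) :
    gradient (potential lam) (planePoint α x z) =
      planePoint α (lam * (x * invCube x z - invCubeCos x z)) (lam * (z * invCube x z)) := by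
  rw [(hasGradientAt_potential lam h).gradient]
  set g : ℝ → E3 := fun θ =>
    (lam / ‖planePoint α x z - circlePoint θ‖ ^ 3) • (planePoint α x z - circlePoint θ) with hg
  have hper : Function.Periodic g (2 * Real.pi) := by
    intro θ
    simp only [hg, circlePoint_periodic θ]
  have hsq : ∀ φ, √(distSq x z φ) ^ 3 ≠ 0 := fun φ => by
    have := distSq_pos h φ; positivity
  have hc := continuous_distSq x z
  have hw : Continuous fun φ => (√(distSq x z φ) ^ 3)⁻¹ := by fun_prop (disch := assumption)
  have hshift : ∫ θ in (0 : ℝ)..(2 * Real.pi), g θ = ∫ φ in (-Real.pi)..Real.pi, g (φ + α) := by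
    rw [intervalIntegral.integral_comp_add_right]
    have := hper.intervalIntegral_add_eq 0 (-Real.pi + α)
    rw [zero_add] at this
    rw [this]
    congr 1; ring
  have hgφ : ∀ φ, g (φ + α) = planePoint α
      (lam * ((x - Real.cos φ) * (√(distSq x z φ) ^ 3)⁻¹)) (lam * (z * (√(distSq x z φ) ^ 3)⁻¹))
      - (lam * (Real.sin φ * (√(distSq x z φ) ^ 3)⁻¹)) • circlePoint (α + Real.pi / 2) := by
    intro φ
    simp only [hg, norm_planePoint_sub]
    ext i
    fin_cases i <;>
      simp [planePoint_eq, circlePoint, Real.cos_add, Real.sin_add] <;> ring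
  have hodd : ∫ φ in (-Real.pi)..Real.pi, lam * (Real.sin φ * (√(distSq x z φ) ^ 3)⁻¹) = 0 := by
    have h1 := intervalIntegral.integral_comp_neg (a := -Real.pi) (b := Real.pi)
      (fun φ => lam * (Real.sin φ * (√(distSq x z φ) ^ 3)⁻¹))
    simp only [Real.sin_neg, distSq, Real.cos_neg, neg_neg, neg_mul, mul_neg,
      intervalIntegral.integral_neg] at h1
    simp only [distSq]
    linarith
  rw [hshift]
  simp only [hgφ, planePoint]
  have i1 : Continuous fun φ => lam * ((x - Real.cos φ) * (√(distSq x z φ) ^ 3)⁻¹) := by fun_prop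
  have i2 : Continuous fun φ => lam * (z * (√(distSq x z φ) ^ 3)⁻¹) := by fun_prop
  have i3 : Continuous fun φ => lam * (Real.sin φ * (√(distSq x z φ) ^ 3)⁻¹) := by fun_prop
  have hsmul : ∀ f : ℝ → ℝ, Continuous f → ∀ v : E3,
      IntervalIntegrable (fun φ => f φ • v) volume (-Real.pi) Real.pi :=
    fun f hf v => (hf.smul continuous_const).intervalIntegrable _ _
  rw [intervalIntegral.integral_sub ((hsmul _ i1 _).add (hsmul _ i2 _)) (hsmul _ i3 _),
    intervalIntegral.integral_add (hsmul _ i1 _) (hsmul _ i2 _),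
    intervalIntegral.integral_smul_const, intervalIntegral.integral_smul_const,
    intervalIntegral.integral_smul_const, hodd, zero_smul, sub_zero]
  congr 2
  · rw [intervalIntegral.integral_const_mul]
    simp only [sub_mul]
    rw [intervalIntegral.integral_sub, intervalIntegral.integral_const_mul]
    · rfl
    · exact Continuous.intervalIntegrable (by fun_prop) _ _
    · exact Continuous.intervalIntegrable (by fun_prop) _ _
  · rw [intervalIntegral.integral_const_mul, intervalIntegral.integral_const_mul]
    rfl

/-! ### From polar orbits to orbits in space -/

/-- For a positive periodic density `w`, the inverse of a primitive of `w` solves `φ' = 1 / w φ`. -/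
lemma exists_time_change {w : ℝ → ℝ} (hw : Continuous w) {m : ℝ} (hm : 0 < m) (hmw : ∀ θ, m ≤ w θ)
    {P : ℝ} (hP : 0 < P) (hper : Function.Periodic w P) :
    ∃ φ : ℝ → ℝ, Function.Surjective φ ∧ (∀ t, HasDerivAt φ (w (φ t))⁻¹ t) ∧
      ∃ T > 0, ∀ t, φ (t + T) = φ t + P := by
  set F : ℝ → ℝ := fun θ => ∫ u in (0 : ℝ)..θ, w u with hF
  have hint : ∀ a b, IntervalIntegrable w volume a b := fun a b => hw.intervalIntegrable a b
  have hF' : ∀ θ, HasDerivAt F (w θ) θ := fun θ => hw.integral_hasStrictDerivAt 0 θ |>.hasDerivAt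
  have hFc : Continuous F := continuous_iff_continuousAt.2 fun θ => (hF' θ).continuousAt
  have hmono : StrictMono F := strictMono_of_deriv_pos fun θ => by
    rw [(hF' θ).deriv]; exact hm.trans_le (hmw θ)
  have hle : ∀ a b, a ≤ b → m * (b - a) ≤ F b - F a := by
    intro a b hab
    simp only [hF]
    rw [intervalIntegral.integral_interval_sub_left (hint _ _) (hint _ _)]
    have := intervalIntegral.integral_mono_on hab
      (intervalIntegrable_const (μ := volume) (c := m)) (hint a b) fun x _ => hmw x
    rw [intervalIntegral.integral_const, smul_eq_mul] at this
    linarith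
  have hF0 : F 0 = 0 := by simp [hF]
  have htop : Tendsto F atTop atTop := by
    refine tendsto_atTop_mono' _ ?_ (tendsto_id.const_mul_atTop hm)
    filter_upwards [eventually_ge_atTop 0] with θ hθ
    have := hle 0 θ hθ
    simp only [id]; linarith
  have hbot : Tendsto F atBot atBot := by
    refine tendsto_atBot_mono' _ ?_ (tendsto_id.const_mul_atBot hm)
    filter_upwards [eventually_le_atBot 0] with θ hθ
    have := hle θ 0 hθ
    simp only [id]; linarith
  have hsurj : Function.Surjective F := hFc.surjective htop hbot
  set e := hmono.orderIsoOfSurjective F hsurj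
  have hFe : ∀ t, F (e.symm t) = t := fun t => e.apply_symm_apply t
  have heF : ∀ θ, e.symm (F θ) = θ := fun θ => e.symm_apply_apply θ
  have hFper : ∀ θ, F (θ + P) = F θ + F P := by
    intro θ
    have h1 := intervalIntegral.integral_add_adjacent_intervals (hint 0 θ) (hint θ (θ + P))
    have h2 := hper.intervalIntegral_add_eq θ 0
    rw [zero_add] at h2
    simp only [hF]
    rw [← h1, h2]
  refine ⟨e.symm, e.symm.surjective, fun t => ?_, F P, ?_, fun t => ?_⟩
  · exact HasDerivAt.of_local_left_inverse e.symm.continuous.continuousAt (hF' _)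
      (hm.trans_le (hmw _)).ne' (.of_forall hFe)
  · have := hmono hP; rwa [hF0] at this
  · rw [← heF (e.symm t + P), hFper, hFe]

lemma hasDerivAt_planePoint (α : ℝ) {x z : ℝ → ℝ} {x' z' t : ℝ} (hx : HasDerivAt x x' t)
    (hz : HasDerivAt z z' t) :
    HasDerivAt (fun t => planePoint α (x t) (z t)) (planePoint α x' z') t :=
  (hx.smul_const _).add (hz.smul_const _)

/-- The polar curve `ρ = r θ` in a vertical plane, scaled by `d` and centered at the point with
horizontal coordinate `c` and height zero. -/
noncomputable def polarCurve (α c d : ℝ) (r : ℝ → ℝ) (θ : ℝ) : E3 :=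
  planePoint α (c + d * (r θ * Real.cos θ)) (d * (r θ * Real.sin θ))

namespace IsPolarOrbit

variable {Fr Ft : ℝ → ℝ → ℝ} {r p L : ℝ → ℝ}

lemma r_pos (h : IsPolarOrbit Fr Ft r p L) (θ : ℝ) : 0 < r θ := by
  have : 1 / 2 ≤ r θ := (h.mem θ).1.1
  linarith

lemma L_pos (h : IsPolarOrbit Fr Ft r p L) (θ : ℝ) : 0 < L θ := by
  have : 1 / 2 ≤ L θ := (h.mem θ).2.2.1
  linarith

lemma continuous_r (h : IsPolarOrbit Fr Ft r p L) : Continuous r :=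
  continuous_iff_continuousAt.2 fun θ => (h.deriv_r θ).continuousAt

lemma continuous_L (h : IsPolarOrbit Fr Ft r p L) : Continuous L :=
  continuous_iff_continuousAt.2 fun θ => (h.deriv_L θ).continuousAt

/-- A polar orbit for the rescaled force of the circle, run with the time `dt = τ r ^ 2 / L dθ`, is
an orbit of the fixed circle problem. -/
theorem exists_isPeriodicOrbit (h : IsPolarOrbit Fr Ft r p L)
    (hr : Function.Periodic r (2 * Real.pi)) (hL : Function.Periodic L (2 * Real.pi))
    {lam α c d τ : ℝ} (hτ : 0 < τ) (hoff : ∀ θ, polarCurve α c d r θ ∉ circle)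
    (hforce : ∀ θ, -gradient (potential lam) (polarCurve α c d r θ) = planePoint α
      (d / τ ^ 2 * (Fr (r θ) θ * Real.cos θ - Ft (r θ) θ * Real.sin θ))
      (d / τ ^ 2 * (Fr (r θ) θ * Real.sin θ + Ft (r θ) θ * Real.cos θ))) :
    ∃ s : ℝ → E3, IsPeriodicOrbit lam s ∧ range s = range (polarCurve α c d r) := by
  have hr0 := h.r_pos
  have hL0 := h.L_pos
  have hL0' : ∀ θ, L θ ≠ 0 := fun θ => (hL0 θ).ne'
  obtain ⟨φ, hsurj, hφ, T, hT, hφT⟩ := exists_time_change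
    (w := fun θ => τ * r θ ^ 2 / L θ) (m := τ / 8) (P := 2 * Real.pi)
    (((continuous_const.mul (h.continuous_r.pow 2))).div h.continuous_L hL0')
    (by positivity)
    (fun θ => by
      rw [le_div_iff₀ (hL0 θ)]
      have h1 : 1 / 2 ≤ r θ := (h.mem θ).1.1
      have h2 : L θ ≤ 2 := (h.mem θ).2.2.2
      have h3 : 1 / 4 ≤ r θ ^ 2 := by nlinarith
      have h4 : L θ / 8 ≤ r θ ^ 2 := by linarith
      nlinarith)
    Real.two_pi_pos
    (fun θ => by simp only [hr θ, hL θ])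
  -- The velocity with respect to the rescaled time, in horizontal and vertical components.
  set u : ℝ → ℝ := fun θ => p θ * Real.cos θ - L θ / r θ * Real.sin θ
  set w : ℝ → ℝ := fun θ => p θ * Real.sin θ + L θ / r θ * Real.cos θ
  have hx : ∀ θ, HasDerivAt (fun θ => r θ * Real.cos θ) (r θ ^ 2 / L θ * u θ) θ := by
    intro θ
    have h1 := (hr0 θ).ne'
    have h2 := hL0' θ
    refine ((h.deriv_r θ).mul (Real.hasDerivAt_cos θ)).congr_deriv ?_
    simp only [u]; field_simp; ring
  have hz : ∀ θ, HasDerivAt (fun θ => r θ * Real.sin θ) (r θ ^ 2 / L θ * w θ) θ := by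
    intro θ
    have h1 := (hr0 θ).ne'
    have h2 := hL0' θ
    refine ((h.deriv_r θ).mul (Real.hasDerivAt_sin θ)).congr_deriv ?_
    simp only [w]; field_simp
  have hu : ∀ θ, HasDerivAt u
      (r θ ^ 2 / L θ * (Fr (r θ) θ * Real.cos θ - Ft (r θ) θ * Real.sin θ)) θ := by
    intro θ
    have h1 := (hr0 θ).ne'
    have h2 := hL0' θ
    refine (((h.deriv_p θ).mul (Real.hasDerivAt_cos θ)).sub
      (((h.deriv_L θ).div (h.deriv_r θ) h1).mul (Real.hasDerivAt_sin θ))).congr_deriv ?_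
    simp only [Pi.div_apply]; field_simp; ring
  have hw : ∀ θ, HasDerivAt w
      (r θ ^ 2 / L θ * (Fr (r θ) θ * Real.sin θ + Ft (r θ) θ * Real.cos θ)) θ := by
    intro θ
    have h1 := (hr0 θ).ne'
    have h2 := hL0' θ
    refine (((h.deriv_p θ).mul (Real.hasDerivAt_sin θ)).add
      (((h.deriv_L θ).div (h.deriv_r θ) h1).mul (Real.hasDerivAt_cos θ))).congr_deriv ?_
    simp only [Pi.div_apply]; field_simp; ring
  refine ⟨fun t => polarCurve α c d r (φ t), ⟨⟨fun t => hoff _, fun t =>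
    planePoint α (d / τ * u (φ t)) (d / τ * w (φ t)), fun t => ⟨?_, ?_⟩⟩, T, hT, fun t => ?_⟩,
    hsurj.range_comp (polarCurve α c d r)⟩
  · have h1 := (hr0 (φ t)).ne'
    have h2 := hL0' (φ t)
    refine (hasDerivAt_planePoint α ((((hx (φ t)).comp t (hφ t)).const_mul d).const_add c)
      (((hz (φ t)).comp t (hφ t)).const_mul d)).congr_deriv ?_
    congr 1 <;> field_simp
  · have h1 := (hr0 (φ t)).ne'
    have h2 := hL0' (φ t)
    rw [hforce]
    refine (hasDerivAt_planePoint α (((hu (φ t)).comp t (hφ t)).const_mul (d / τ))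
      (((hw (φ t)).comp t (hφ t)).const_mul (d / τ))).congr_deriv ?_
    congr 1 <;> field_simp
  · simp only [hφT, polarCurve, hr (φ t), Real.cos_add_two_pi, Real.sin_add_two_pi]

end IsPolarOrbit

/-! ### Polar curves are simple closed curves around their center -/

lemma planePoint_injective {α x z x' z' : ℝ} (h : planePoint α x z = planePoint α x' z') :
    x = x' ∧ z = z' := by
  simp only [planePoint_eq] at h
  have h0 := congrArg (fun v : E3 => v 0) h
  have h1 := congrArg (fun v : E3 => v 1) h
  have h2 := congrArg (fun v : E3 => v 2) h
  simp at h0 h1 h2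
  refine ⟨?_, h2⟩
  have hcs := Real.sin_sq_add_cos_sq α
  rcases h0 with h0 | h0
  · exact h0
  · rcases h1 with h1 | h1
    · exact h1
    · simp [h0, h1] at hcs

/-- The position of a point of a vertical plane relative to the center of a polar curve, as a
complex number in units of the scale. -/
noncomputable def relPos (α c d : ℝ) (y : E3) : ℂ :=
  ⟨(y 0 * Real.cos α + y 1 * Real.sin α - c) / d, y 2 / d⟩

lemma continuous_relPos (α c d : ℝ) : Continuous (relPos α c d) := by
  have h : relPos α c d = fun y : E3 => (((y 0 * Real.cos α + y 1 * Real.sin α - c) / d : ℝ) : ℂ) +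
      ((y 2 / d : ℝ) : ℂ) * Complex.I := by
    ext1 y
    exact Complex.mk_eq_add_mul_I _ _
  rw [h]
  fun_prop

lemma relPos_planePoint (α c d x z : ℝ) :
    relPos α c d (planePoint α x z) = ⟨(x - c) / d, z / d⟩ := by
  have hcs := Real.sin_sq_add_cos_sq α
  simp only [relPos, planePoint_eq]
  congr 2
  simp
  linear_combination x * hcs

lemma norm_planePoint_le (α x z : ℝ) : ‖planePoint α x z‖ ≤ |x| + |z| := by
  have h1 : ‖circlePoint α‖ = 1 := by
    simp [circlePoint, EuclideanSpace.norm_eq, Fin.sum_univ_three]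
  refine (norm_add_le _ _).trans ?_
  simp [norm_smul, h1]

section

variable {r : ℝ → ℝ} {α c d : ℝ}

lemma continuous_polarCurve (hr : Continuous r) : Continuous (polarCurve α c d r) := by
  unfold polarCurve planePoint
  fun_prop

lemma polarCurve_periodic (hr : Function.Periodic r (2 * Real.pi)) :
    Function.Periodic (polarCurve α c d r) (2 * Real.pi) := by
  intro θ
  simp [polarCurve, hr θ]

lemma isSimpleClosedCurve_polarCurve (hd : 0 < d) (hrc : Continuous r) (hr0 : ∀ θ, 0 < r θ)
    (hr : Function.Periodic r (2 * Real.pi)) :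
    IsSimpleClosedCurve (range (polarCurve α c d r)) := by
  refine ⟨fun s => polarCurve α c d r (2 * Real.pi * s),
    (continuous_polarCurve hrc).comp (by fun_prop), fun s => ?_, fun s hs t ht hst => ?_, ?_⟩
  · simp only [mul_add, mul_one, polarCurve_periodic hr _]
  · set a := 2 * Real.pi * s with ha
    set b := 2 * Real.pi * t with hb
    obtain ⟨h1, h2⟩ := planePoint_injective hst
    have h1' : r a * Real.cos a = r b * Real.cos b := mul_left_cancel₀ hd.ne' (add_left_cancel h1)
    have h2' : r a * Real.sin a = r b * Real.sin b := mul_left_cancel₀ hd.ne' h2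
    have hab : r a = r b := by
      have h3 : r a ^ 2 = r b ^ 2 := by
        have e1 := Real.sin_sq_add_cos_sq a
        have e2 := Real.sin_sq_add_cos_sq b
        linear_combination (r a * Real.cos a + r b * Real.cos b) * h1' +
          (r a * Real.sin a + r b * Real.sin b) * h2' - r a ^ 2 * e1 + r b ^ 2 * e2
      exact (pow_left_inj₀ (hr0 a).le (hr0 b).le two_ne_zero).1 h3
    rw [hab] at h1' h2'
    have hang := Real.Angle.cos_sin_inj (mul_left_cancel₀ (hr0 b).ne' h1')
      (mul_left_cancel₀ (hr0 b).ne' h2')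
    obtain ⟨k, hk⟩ := Real.Angle.angle_eq_iff_two_pi_dvd_sub.1 hang
    have hst' : s - t = k := by
      have : 2 * Real.pi * (s - t) = 2 * Real.pi * k := by rw [← hk, ha, hb]; ring
      exact mul_left_cancel₀ Real.two_pi_pos.ne' this
    have hk0 : k = 0 := by
      have l1 : (-1 : ℝ) < k := by rw [← hst']; linarith [hs.1, ht.2]
      have l2 : (k : ℝ) < 1 := by rw [← hst']; linarith [hs.2, ht.1]
      have l1' : -1 < k := by exact_mod_cast l1
      have l2' : k < 1 := by exact_mod_cast l2
      omega
    rw [hk0] at hst'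
    simpa [sub_eq_zero] using hst'
  · refine Function.Surjective.range_comp (f := fun s : ℝ => 2 * Real.pi * s) (fun θ => ?_)
      (polarCurve α c d r)
    exact ⟨θ / (2 * Real.pi), by field_simp⟩

lemma planePoint_mem_range_polarCurve (hd : 0 < d) (x z : ℝ)
    (h : ‖relPos α c d (planePoint α x z)‖ = r (relPos α c d (planePoint α x z)).arg) :
    planePoint α x z ∈ range (polarCurve α c d r) := by
  rw [relPos_planePoint] at h
  set w : ℂ := ⟨(x - c) / d, z / d⟩ with hw
  have h1 := Complex.norm_mul_cos_arg w
  have h2 := Complex.norm_mul_sin_arg w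
  have hwre : w.re = (x - c) / d := rfl
  have hwim : w.im = z / d := rfl
  refine ⟨w.arg, ?_⟩
  rw [polarCurve, ← h, h1, h2, hwre, hwim]
  congr 1 <;> field_simp
  ring

/-- A polar curve separates the points of smaller from the points of larger radius. -/
lemma encloses_polarCurve (hd : 0 < d) (hrc : Continuous r)
    (hrb : ∀ θ, r θ ∈ Icc (1 / 2 : ℝ) 2) (hr : Function.Periodic r (2 * Real.pi))
    {P : Submodule ℝ E3} (hP : ∀ y, y ∈ P ↔ ∃ x z, y = planePoint α x z) :
    Encloses P (range (polarCurve α c d r)) (planePoint α c 0) := by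
  have hr0 : ∀ θ, 0 < r θ := fun θ => by linarith [(hrb θ).1]
  set S := range (polarCurve α c d r) with hS
  have hcenter : planePoint α c 0 ∈ (P : Set E3) \ S := by
    refine ⟨(hP _).2 ⟨_, _, rfl⟩, ?_⟩
    rintro ⟨θ, hθ⟩
    obtain ⟨h1, h2⟩ := planePoint_injective hθ
    have h1' : Real.cos θ = 0 := by
      have : d * (r θ * Real.cos θ) = 0 := by linarith
      simpa [hd.ne', (hr0 θ).ne'] using this
    have h2' : Real.sin θ = 0 := by simpa [hd.ne', (hr0 θ).ne'] using h2
    have := Real.sin_sq_add_cos_sq θ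
    simp [h1', h2'] at this
  refine ⟨hcenter, ?_⟩
  set ψ := relPos α c d with hψ
  have hψc : Continuous ψ := continuous_relPos α c d
  have hrarg : ∀ w : ℂ, w ≠ 0 → ContinuousAt (fun w : ℂ => r w.arg) w := by
    intro w hw
    have hlift : Continuous (hr.lift : Real.Angle → ℝ) := hrc.quotient_lift _
    exact hlift.continuousAt.comp (Complex.continuousAt_arg_coe_angle hw)
  have hrψ : ∀ y, ψ y ≠ 0 → ContinuousAt (fun y => r (ψ y).arg) y := fun y hy =>
    ContinuousAt.comp (f := ψ) (g := fun w : ℂ => r w.arg) (hrarg _ hy) hψc.continuousAt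
  set U : Set E3 := {y | ‖ψ y‖ < 1 / 2} ∪ {y | ψ y ≠ 0 ∧ ‖ψ y‖ < r (ψ y).arg} with hU
  set V : Set E3 := {y | ψ y ≠ 0 ∧ r (ψ y).arg < ‖ψ y‖} with hV
  have hUo : IsOpen U := by
    refine (isOpen_lt hψc.norm continuous_const).union (isOpen_iff_mem_nhds.2 fun y hy => ?_)
    exact (hψc.continuousAt.eventually_ne hy.1).and
      (hψc.norm.continuousAt.eventually_lt (hrψ y hy.1) hy.2)
  have hVo : IsOpen V := by
    refine isOpen_iff_mem_nhds.2 fun y hy => ?_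
    exact (hψc.continuousAt.eventually_ne hy.1).and
      ((hrψ y hy.1).eventually_lt hψc.norm.continuousAt hy.2)
  have hUV : Disjoint U V := by
    rw [Set.disjoint_left]
    rintro y (hy | hy) hy'
    · have h1 := (hrb (ψ y).arg).1
      have h2 : ‖ψ y‖ < 1 / 2 := hy
      have h3 := hy'.2
      linarith
    · exact lt_asymm hy.2 hy'.2
  have hcover : connectedComponentIn ((P : Set E3) \ S) (planePoint α c 0) ⊆ U ∪ V := by
    intro y hy
    obtain ⟨hyP, hyS⟩ := connectedComponentIn_subset _ _ hy
    obtain ⟨x, z, rfl⟩ := (hP y).1 hyP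
    by_cases h0 : ψ (planePoint α x z) = 0
    · left; left; simp [h0]
    · rcases lt_trichotomy ‖ψ (planePoint α x z)‖ (r (ψ (planePoint α x z)).arg) with h | h | h
      · exact .inl (.inr ⟨h0, h⟩)
      · exact absurd (planePoint_mem_range_polarCurve hd x z h) hyS
      · exact .inr ⟨h0, h⟩
  have hsub := isPreconnected_connectedComponentIn.subset_left_of_subset_union hUo hVo hUV hcover
    ⟨planePoint α c 0, mem_connectedComponentIn hcenter, by
      left
      have : ψ (planePoint α c 0) = 0 := by rw [hψ, relPos_planePoint]; apply Complex.ext <;> simp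
      simp [this]⟩
  refine (Metric.isBounded_closedBall (x := (0 : E3)) (r := |c| + d * 2 + d * 2)).subset
    fun y hy => ?_
  obtain ⟨x, z, rfl⟩ := (hP y).1 (connectedComponentIn_subset _ _ hy).1
  have hn : ‖ψ (planePoint α x z)‖ ≤ 2 := by
    rcases hsub hy with h | h
    · have h : ‖ψ (planePoint α x z)‖ < 1 / 2 := h
      linarith
    · exact h.2.le.trans (hrb _).2
  rw [hψ, relPos_planePoint] at hn
  have hre := (Complex.abs_re_le_norm _).trans hn
  have him := (Complex.abs_im_le_norm _).trans hn
  simp only [abs_div, abs_of_pos hd, div_le_iff₀ hd] at hre him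
  rw [mem_closedBall_zero_iff]
  have h1 := norm_planePoint_le α x z
  have h2 := abs_sub_abs_le_abs_sub x c
  linarith

lemma reflHorizontal_planePoint (α x z : ℝ) :
    reflHorizontal (planePoint α x z) = planePoint α x (-z) := by
  simp [reflHorizontal, planePoint_eq]

lemma reflZAxis_planePoint (α x z : ℝ) :
    reflZAxis (planePoint α x z) = planePoint α (-x) z := by
  simp [reflZAxis, planePoint_eq]

lemma reflHorizontal_image_polarCurve (hr : ∀ θ, r (-θ) = r θ) :
    reflHorizontal '' range (polarCurve α c d r) = range (polarCurve α c d r) := by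
  have h : reflHorizontal ∘ polarCurve α c d r = polarCurve α c d r ∘ Neg.neg := by
    ext1 θ
    simp [polarCurve, reflHorizontal_planePoint, hr]
  rw [← range_comp, h, neg_surjective.range_comp]

lemma reflZAxis_image_polarCurve (hr : ∀ θ, r (Real.pi - θ) = r θ) :
    reflZAxis '' range (polarCurve α 0 d r) = range (polarCurve α 0 d r) := by
  have h : reflZAxis ∘ polarCurve α 0 d r = polarCurve α 0 d r ∘ fun θ => Real.pi - θ := by
    ext1 θ
    simp [polarCurve, reflZAxis_planePoint, hr]
  rw [← range_comp, h]
  exact Function.Surjective.range_comp (fun θ => ⟨Real.pi - θ, by simp⟩) _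

end

lemma mem_iff_exists_planePoint {P : Submodule ℝ E3} (hP : IsVerticalPlane P) {α : ℝ}
    (hα : circlePoint α ∈ P) (y : E3) : y ∈ P ↔ ∃ x z, y = planePoint α x z := by
  constructor
  · intro hy
    have hli : LinearIndependent ℝ ![circlePoint α, EuclideanSpace.single (2 : Fin 3) (1 : ℝ)] := by
      rw [LinearIndependent.pair_iff]
      intro s t hst
      have h0 : planePoint α s t = planePoint α 0 0 := by simpa [planePoint] using hst
      exact planePoint_injective h0
    have hle : Submodule.span ℝ (range ![circlePoint α, EuclideanSpace.single (2 : Fin 3) (1 : ℝ)])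
        ≤ P := by
      rw [Submodule.span_le, Matrix.range_cons, Matrix.range_cons, Matrix.range_empty]
      rintro v (rfl | rfl | h)
      · exact hα
      · exact hP.2
      · exact h.elim
    have heq := Submodule.eq_of_le_of_finrank_eq hle
      (by rw [finrank_span_eq_card hli, hP.1]; simp)
    rw [← heq, Matrix.range_cons, Matrix.range_cons, Matrix.range_empty, union_empty,
      singleton_union, Submodule.mem_span_pair] at hy
    obtain ⟨x, z, h⟩ := hy
    exact ⟨x, z, h.symm⟩
  · rintro ⟨x, z, rfl⟩
    exact P.add_mem (P.smul_mem _ hα) (P.smul_mem _ hP.2)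

lemma exists_circlePoint_mem {P : Submodule ℝ E3} (hP : IsVerticalPlane P) :
    ∃ α, circlePoint α ∈ P := by
  obtain ⟨y, hyP, hy⟩ : ∃ y ∈ P,
      y ∉ Submodule.span ℝ {EuclideanSpace.single (2 : Fin 3) (1 : ℝ)} := by
    by_contra! h
    have h1 := Submodule.finrank_mono (show P ≤ Submodule.span ℝ _ from h)
    rw [hP.1] at h1
    have h2 := finrank_span_singleton (K := ℝ)
      (v := (EuclideanSpace.single (2 : Fin 3) (1 : ℝ) : E3)) (by simp)
    exact absurd (h1.trans h2.le) (by norm_num)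
  set w : ℂ := ⟨y 0, y 1⟩ with hw
  have hw0 : w ≠ 0 := by
    intro h0
    refine hy (Submodule.mem_span_singleton.2 ⟨y 2, ?_⟩)
    have e0 : y 0 = 0 := congrArg Complex.re h0
    have e1 : y 1 = 0 := congrArg Complex.im h0
    ext i; fin_cases i <;> simp [e0, e1]
  refine ⟨w.arg, ?_⟩
  have h1 : ‖w‖ * Real.cos w.arg = y 0 := Complex.norm_mul_cos_arg w
  have h2 : ‖w‖ * Real.sin w.arg = y 1 := Complex.norm_mul_sin_arg w
  have h3 : circlePoint w.arg =
      ‖w‖⁻¹ • (y - y 2 • EuclideanSpace.single (2 : Fin 3) (1 : ℝ)) := by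
    have hn : ‖w‖ ≠ 0 := norm_ne_zero_iff.2 hw0
    have e1 : Real.cos w.arg = ‖w‖⁻¹ * y 0 := by rw [← h1, inv_mul_cancel_left₀ hn]
    have e2 : Real.sin w.arg = ‖w‖⁻¹ * y 1 := by rw [← h2, inv_mul_cancel_left₀ hn]
    ext i; fin_cases i <;> simp [circlePoint, e1, e2]
  rw [h3]
  exact P.smul_mem _ (P.sub_mem hyP (P.smul_mem _ hP.2))

/-! ### The rescaled attraction of the circle in polar coordinates -/

/-- The integral of the inverse cubed distance, at the point with polar coordinates `r`, `θ` around
the point with horizontal coordinate `c`, in units of `d`. -/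
noncomputable def polarCube (c d r θ : ℝ) : ℝ :=
  invCube (c + d * (r * Real.cos θ)) (d * (r * Real.sin θ))

/-- The integral of `c - cos φ`, weighted by the inverse cubed distance, at the point with polar
coordinates `r`, `θ` around the point with horizontal coordinate `c`, in units of `d`. -/
noncomputable def polarDefect (c d r θ : ℝ) : ℝ :=
  c * polarCube c d r θ - invCubeCos (c + d * (r * Real.cos θ)) (d * (r * Real.sin θ))

/-- The radial component of the attraction of the circle, scaled by `k`. -/
noncomputable def radialForce (c d k r θ : ℝ) : ℝ :=
  -(k * (d * r * polarCube c d r θ + Real.cos θ * polarDefect c d r θ))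

/-- The transversal component of the attraction of the circle, scaled by `k`. -/
noncomputable def transversalForce (c d k r θ : ℝ) : ℝ :=
  k * (Real.sin θ * polarDefect c d r θ)

/-- The squared distance of the point with polar coordinates `r`, `θ` around the point with
horizontal coordinate `c`, in units of `d`, from the point of the circle at the angle `φ`. -/
noncomputable def polarDistSq (c d : ℝ) (q : ℝ × ℝ × ℝ) : ℝ :=
  distSq (c + d * (q.1 * Real.cos q.2.1)) (d * (q.1 * Real.sin q.2.1)) q.2.2

lemma contDiff_polarDistSq (c d : ℝ) : ContDiff ℝ 1 (polarDistSq c d) := by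
  have e1 : ContDiff ℝ 1 fun q : ℝ × ℝ × ℝ => Real.cos q.2.1 :=
    Real.contDiff_cos.comp (contDiff_fst.comp contDiff_snd)
  have e2 : ContDiff ℝ 1 fun q : ℝ × ℝ × ℝ => Real.sin q.2.1 :=
    Real.contDiff_sin.comp (contDiff_fst.comp contDiff_snd)
  have e3 : ContDiff ℝ 1 fun q : ℝ × ℝ × ℝ => Real.cos q.2.2 :=
    Real.contDiff_cos.comp (contDiff_snd.comp contDiff_snd)
  have e4 : ContDiff ℝ 1 fun q : ℝ × ℝ × ℝ => q.1 := contDiff_fst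
  unfold polarDistSq distSq
  fun_prop

/-- Integration over the circle of a smooth function on the annulus gives a function that is
Lipschitz in the radius. -/
lemma exists_lipschitzOnWith_integral {g : ℝ × ℝ × ℝ → ℝ}
    (hg : ∀ q : ℝ × ℝ × ℝ, q.1 ∈ Icc (1 / 2 : ℝ) 2 → ContDiffAt ℝ 1 g q)
    (hper : ∀ r φ, Function.Periodic (fun θ => g (r, θ, φ)) (2 * Real.pi)) :
    ∃ K, ∀ θ, LipschitzOnWith K (fun r => ∫ φ in (-Real.pi)..Real.pi, g (r, θ, φ))
      (Icc (1 / 2) 2) := by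
  have hpi := Real.pi_pos
  set S : Set (ℝ × ℝ × ℝ) := Icc (1 / 2) 2 ×ˢ Icc 0 (2 * Real.pi) ×ˢ Icc (-Real.pi) Real.pi
  have hS : IsCompact S := isCompact_Icc.prod (isCompact_Icc.prod isCompact_Icc)
  obtain ⟨K, hK⟩ : ∃ K, LipschitzOnWith K g S := by
    refine LocallyLipschitzOn.exists_lipschitzOnWith_of_compact hS fun q hq => ?_
    obtain ⟨K, t, ht, h⟩ := (hg q hq.1).exists_lipschitzOnWith
    exact ⟨K, t, mem_nhdsWithin_of_mem_nhds ht, h⟩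
  have hint : ∀ r ∈ Icc (1 / 2 : ℝ) 2, ∀ θ,
      IntervalIntegrable (fun φ => g (r, θ, φ)) volume (-Real.pi) Real.pi := by
    intro r hr θ
    refine Continuous.intervalIntegrable (continuous_iff_continuousAt.2 fun φ => ?_) _ _
    exact ContinuousAt.comp (f := fun φ : ℝ => (r, θ, φ)) (hg (r, θ, φ) hr).continuousAt
      (by fun_prop)
  refine ⟨K * (2 * Real.pi).toNNReal, fun θ => LipschitzOnWith.of_dist_le_mul fun a ha b hb => ?_⟩
  obtain ⟨θ', hθ', hθθ'⟩ : ∃ θ' ∈ Ico 0 (2 * Real.pi), ∀ r φ, g (r, θ, φ) = g (r, θ', φ) :=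
    ⟨toIcoMod Real.two_pi_pos 0 θ, by simpa using toIcoMod_mem_Ico Real.two_pi_pos 0 θ, fun r φ =>
      ((hper r φ).sub_zsmul_eq (toIcoDiv Real.two_pi_pos 0 θ)).symm⟩
  simp only [hθθ']
  rw [Real.dist_eq, ← intervalIntegral.integral_sub (hint a ha _) (hint b hb _), ← Real.norm_eq_abs]
  have := intervalIntegral.norm_integral_le_of_norm_le_const
    (a := -Real.pi) (b := Real.pi) (C := K * dist a b) (f := fun φ => g (a, θ', φ) - g (b, θ', φ))
    (fun φ hφ => by
      rw [uIoc_of_le (by linarith)] at hφ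
      have hm : ∀ r ∈ Icc (1 / 2 : ℝ) 2, (r, θ', φ) ∈ S := fun r hr =>
        ⟨hr, Ico_subset_Icc_self hθ', Ioc_subset_Icc_self hφ⟩
      have := hK.dist_le_mul _ (hm a ha) _ (hm b hb)
      rw [← dist_eq_norm]
      refine this.trans_eq ?_
      simp [Prod.dist_eq])
  refine this.trans_eq ?_
  rw [abs_of_nonneg (by linarith), NNReal.coe_mul, Real.coe_toNNReal _ Real.two_pi_pos.le]
  ring

section

variable {c d : ℝ}

lemma contDiffAt_polarDistSq_inv (hoff : ∀ q : ℝ × ℝ × ℝ, q.1 ∈ Icc (1 / 2 : ℝ) 2 →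
    0 < polarDistSq c d q) {q : ℝ × ℝ × ℝ} (hq : q.1 ∈ Icc (1 / 2 : ℝ) 2) :
    ContDiffAt ℝ 1 (fun q => (√(polarDistSq c d q) ^ 3)⁻¹) q := by
  have h := hoff q hq
  exact (((contDiff_polarDistSq c d).contDiffAt.sqrt h.ne').pow 3).inv (by positivity)

lemma force_eq_integral (hoff : ∀ q : ℝ × ℝ × ℝ, q.1 ∈ Icc (1 / 2 : ℝ) 2 → 0 < polarDistSq c d q)
    (k : ℝ) {r : ℝ} (hr : r ∈ Icc (1 / 2 : ℝ) 2) (θ : ℝ) :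
    (radialForce c d k r θ = ∫ φ in (-Real.pi)..Real.pi,
      -(k * (d * r + Real.cos θ * (c - Real.cos φ))) * (√(polarDistSq c d (r, θ, φ)) ^ 3)⁻¹) ∧
    transversalForce c d k r θ = ∫ φ in (-Real.pi)..Real.pi,
      k * (Real.sin θ * (c - Real.cos φ)) * (√(polarDistSq c d (r, θ, φ)) ^ 3)⁻¹ := by
  have hw : Continuous fun φ => (√(polarDistSq c d (r, θ, φ)) ^ 3)⁻¹ :=
    continuous_iff_continuousAt.2 fun φ =>
      ContinuousAt.comp (f := fun φ : ℝ => (r, θ, φ)) (g := fun q => (√(polarDistSq c d q) ^ 3)⁻¹)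
        (contDiffAt_polarDistSq_inv hoff (q := (r, θ, φ)) hr).continuousAt (by fun_prop)
  have i1 := hw.intervalIntegrable (μ := volume) (-Real.pi) Real.pi
  have i2 : IntervalIntegrable (fun φ => Real.cos φ * (√(polarDistSq c d (r, θ, φ)) ^ 3)⁻¹) volume
      (-Real.pi) Real.pi := (Real.continuous_cos.mul hw).intervalIntegrable _ _
  have hA : polarCube c d r θ = ∫ φ in (-Real.pi)..Real.pi,
    (√(polarDistSq c d (r, θ, φ)) ^ 3)⁻¹ := rfl
  have hB : invCubeCos (c + d * (r * Real.cos θ)) (d * (r * Real.sin θ)) =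
    ∫ φ in (-Real.pi)..Real.pi, Real.cos φ * (√(polarDistSq c d (r, θ, φ)) ^ 3)⁻¹ := rfl
  have key : ∀ a b : ℝ, ∫ φ in (-Real.pi)..Real.pi,
      (a + b * (c - Real.cos φ)) * (√(polarDistSq c d (r, θ, φ)) ^ 3)⁻¹ =
      a * polarCube c d r θ + b * polarDefect c d r θ := by
    intro a b
    rw [polarDefect, hB, hA, ← intervalIntegral.integral_const_mul,
      ← intervalIntegral.integral_const_mul,
      ← intervalIntegral.integral_sub (i1.const_mul c) i2, ← intervalIntegral.integral_const_mul,
      ← intervalIntegral.integral_add (i1.const_mul a) (((i1.const_mul c).sub i2).const_mul b)]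
    refine intervalIntegral.integral_congr fun φ _ => ?_
    ring
  constructor
  · have h := key (-(k * (d * r))) (-(k * Real.cos θ))
    rw [radialForce, show -(k * (d * r * polarCube c d r θ + Real.cos θ * polarDefect c d r θ)) =
      -(k * (d * r)) * polarCube c d r θ + -(k * Real.cos θ) * polarDefect c d r θ by ring, ← h]
    refine intervalIntegral.integral_congr fun φ _ => ?_
    ring
  · have h := key 0 (k * Real.sin θ)
    rw [transversalForce, show k * (Real.sin θ * polarDefect c d r θ) =
      0 * polarCube c d r θ + k * Real.sin θ * polarDefect c d r θ by ring, ← h]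
    refine intervalIntegral.integral_congr fun φ _ => ?_
    ring

/-- Off the circle the attraction is regular; together with the estimate `near`, this gives all the
properties of a nearly radial force. -/
lemma isNearRadial_of_near
    (hoff : ∀ q : ℝ × ℝ × ℝ, q.1 ∈ Icc (1 / 2 : ℝ) 2 → 0 < polarDistSq c d q)
    {Θ k η : ℝ} {f : ℝ → ℝ}
    (near : ∀ r ∈ Icc (1 / 2 : ℝ) 2, ∀ θ,
      |k * (d * r) * polarCube c d r θ + f r| ≤ η / 2 ∧ |k * polarDefect c d r θ| ≤ η / 2)
    (reflect' : ∀ r θ, radialForce c d k r (2 * Θ - θ) = radialForce c d k r θ ∧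
      transversalForce c d k r (2 * Θ - θ) = -transversalForce c d k r θ) :
    IsNearRadial Θ f η (radialForce c d k) (transversalForce c d k) := by
  have e1 : ContDiff ℝ 1 fun q : ℝ × ℝ × ℝ => Real.cos q.2.1 :=
    Real.contDiff_cos.comp (contDiff_fst.comp contDiff_snd)
  have e2 : ContDiff ℝ 1 fun q : ℝ × ℝ × ℝ => Real.sin q.2.1 :=
    Real.contDiff_sin.comp (contDiff_fst.comp contDiff_snd)
  have e3 : ContDiff ℝ 1 fun q : ℝ × ℝ × ℝ => Real.cos q.2.2 :=
    Real.contDiff_cos.comp (contDiff_snd.comp contDiff_snd)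
  have e4 : ContDiff ℝ 1 fun q : ℝ × ℝ × ℝ => q.1 := contDiff_fst
  have hF : ContDiff ℝ 1 fun q : ℝ × ℝ × ℝ =>
      -(k * (d * q.1 + Real.cos q.2.1 * (c - Real.cos q.2.2))) := by fun_prop
  have hT : ContDiff ℝ 1 fun q : ℝ × ℝ × ℝ =>
      k * (Real.sin q.2.1 * (c - Real.cos q.2.2)) := by fun_prop
  have hFw : ∀ q : ℝ × ℝ × ℝ, q.1 ∈ Icc (1 / 2 : ℝ) 2 → ContDiffAt ℝ 1 (fun q =>
      -(k * (d * q.1 + Real.cos q.2.1 * (c - Real.cos q.2.2))) * (√(polarDistSq c d q) ^ 3)⁻¹) q :=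
    fun q hq => hF.contDiffAt.mul (contDiffAt_polarDistSq_inv hoff hq)
  have hTw : ∀ q : ℝ × ℝ × ℝ, q.1 ∈ Icc (1 / 2 : ℝ) 2 → ContDiffAt ℝ 1 (fun q =>
      k * (Real.sin q.2.1 * (c - Real.cos q.2.2)) * (√(polarDistSq c d q) ^ 3)⁻¹) q :=
    fun q hq => hT.contDiffAt.mul (contDiffAt_polarDistSq_inv hoff hq)
  refine ⟨?_, fun r hr => ?_, fun r hr θ => ?_, fun r θ => ?_, reflect'⟩
  · obtain ⟨K₁, h₁⟩ := exists_lipschitzOnWith_integral hFw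
      (fun r φ θ => by simp only [polarDistSq, Real.cos_add_two_pi, Real.sin_add_two_pi])
    obtain ⟨K₂, h₂⟩ := exists_lipschitzOnWith_integral hTw
      (fun r φ θ => by simp only [polarDistSq, Real.cos_add_two_pi, Real.sin_add_two_pi])
    refine ⟨max K₁ K₂, fun θ => ⟨?_, ?_⟩⟩
    · intro x hx y hy
      simp only [(force_eq_integral hoff k hx θ).1, (force_eq_integral hoff k hy θ).1]
      exact (h₁ θ).weaken (le_max_left _ _) hx hy
    · intro x hx y hy
      simp only [(force_eq_integral hoff k hx θ).2, (force_eq_integral hoff k hy θ).2]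
      exact (h₂ θ).weaken (le_max_right _ _) hx hy
  · have hcont : ∀ g : ℝ × ℝ × ℝ → ℝ,
        (∀ q : ℝ × ℝ × ℝ, q.1 ∈ Icc (1 / 2 : ℝ) 2 → ContDiffAt ℝ 1 g q) →
        Continuous fun θ => ∫ φ in (-Real.pi)..Real.pi, g (r, θ, φ) := by
      intro g hg
      refine intervalIntegral.continuous_parametric_intervalIntegral_of_continuous'
        (f := fun θ φ => g (r, θ, φ)) (continuous_iff_continuousAt.2 fun x => ?_) _ _
      exact ContinuousAt.comp (f := fun x : ℝ × ℝ => (r, x.1, x.2)) (g := g)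
        (hg (r, x.1, x.2) hr).continuousAt (by fun_prop)
    constructor
    · rw [funext fun θ => (force_eq_integral hoff k hr θ).1]
      exact hcont _ hFw
    · rw [funext fun θ => (force_eq_integral hoff k hr θ).2]
      exact hcont _ hTw
  · obtain ⟨h1, h2⟩ := near r hr θ
    have hc : |Real.cos θ * (k * polarDefect c d r θ)| ≤ η / 2 := by
      rw [abs_mul]
      exact (mul_le_of_le_one_left (abs_nonneg _) (Real.abs_cos_le_one θ)).trans h2
    have hs : |Real.sin θ * (k * polarDefect c d r θ)| ≤ η / 2 := by
      rw [abs_mul]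
      exact (mul_le_of_le_one_left (abs_nonneg _) (Real.abs_sin_le_one θ)).trans h2
    have h3 := (abs_nonneg _).trans h2
    constructor
    · rw [radialForce,
        show -(k * (d * r * polarCube c d r θ + Real.cos θ * polarDefect c d r θ)) - f r =
          -((k * (d * r) * polarCube c d r θ + f r) + Real.cos θ * (k * polarDefect c d r θ)) by
            ring, abs_neg]
      have := abs_add_le (k * (d * r) * polarCube c d r θ + f r)
        (Real.cos θ * (k * polarDefect c d r θ))
      linarith
    · rw [transversalForce, mul_left_comm]
      linarith
  · simp [radialForce, transversalForce, polarDefect, polarCube, invCube, invCubeCos, distSq]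

end

/-- The gradient of the potential along a polar curve, in terms of the polar components of the
force. -/
lemma neg_gradient_polarCurve {lam α c d τ : ℝ} (hd : d ≠ 0) (hτ : τ ≠ 0) {r : ℝ → ℝ} {θ : ℝ}
    (hoff : polarCurve α c d r θ ∉ circle) :
    -gradient (potential lam) (polarCurve α c d r θ) = planePoint α
      (d / τ ^ 2 * (radialForce c d (lam * τ ^ 2 / d) (r θ) θ * Real.cos θ -
        transversalForce c d (lam * τ ^ 2 / d) (r θ) θ * Real.sin θ))
      (d / τ ^ 2 * (radialForce c d (lam * τ ^ 2 / d) (r θ) θ * Real.sin θ +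
        transversalForce c d (lam * τ ^ 2 / d) (r θ) θ * Real.cos θ)) := by
  have hneg : ∀ x z, -planePoint α x z = planePoint α (-x) (-z) := fun x z => by
    simp [planePoint, add_comm]
  have hcs := Real.sin_sq_add_cos_sq θ
  rw [polarCurve, gradient_potential_planePoint lam hoff, hneg]
  simp only [radialForce, transversalForce, polarDefect, polarCube]
  generalize invCube (c + d * (r θ * Real.cos θ)) (d * (r θ * Real.sin θ)) = A
  generalize invCubeCos (c + d * (r θ * Real.cos θ)) (d * (r θ * Real.sin θ)) = B
  congr 1
  · field_simp
    linear_combination lam * (c * A - B) * hcs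
  · field_simp
    ring

/-! ### The attraction far from the circle -/

lemma polarDistSq_zero (d r θ φ : ℝ) :
    polarDistSq 0 d (r, θ, φ) = (d * r) ^ 2 + 1 - 2 * (d * r) * (Real.cos θ * Real.cos φ) := by
  have := Real.sin_sq_add_cos_sq θ
  simp only [polarDistSq, distSq]
  linear_combination (d * r) ^ 2 * this

lemma abs_sqrt_polarDistSq_sub_le {d r : ℝ} (h : 1 ≤ d * r) (θ φ : ℝ) :
    |√(polarDistSq 0 d (r, θ, φ)) - d * r| ≤ 1 := by
  have hc : |Real.cos θ * Real.cos φ| ≤ 1 := by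
    rw [abs_mul]
    exact mul_le_one₀ (Real.abs_cos_le_one _) (abs_nonneg _) (Real.abs_cos_le_one _)
  have hc := abs_le.1 hc
  have h1 : d * r - 1 ≤ √(polarDistSq 0 d (r, θ, φ)) := by
    apply Real.le_sqrt_of_sq_le
    rw [polarDistSq_zero]
    nlinarith
  have h2 : √(polarDistSq 0 d (r, θ, φ)) ≤ d * r + 1 := by
    rw [Real.sqrt_le_left (by linarith), polarDistSq_zero]
    nlinarith
  rw [abs_le]
  constructor <;> linarith

lemma abs_inv_cube_sub_le {D R : ℝ} (hR : 2 ≤ R) (h : |D - R| ≤ 1) :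
    |(D ^ 3)⁻¹ - (R ^ 3)⁻¹| ≤ 38 / R ^ 4 := by
  have h' := abs_le.1 h
  have hD : R / 2 ≤ D := by linarith
  have hR0 : 0 < R := by linarith
  have hD0 : 0 < D := by linarith
  have e : (D ^ 3)⁻¹ - (R ^ 3)⁻¹ = -((D - R) * (D ^ 2 + D * R + R ^ 2)) / (D ^ 3 * R ^ 3) := by
    field_simp; ring
  have h1 : |-((D - R) * (D ^ 2 + D * R + R ^ 2))| ≤ 19 / 4 * R ^ 2 := by
    rw [abs_neg, abs_mul, abs_of_pos (by positivity : 0 < D ^ 2 + D * R + R ^ 2)]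
    have : D ^ 2 + D * R + R ^ 2 ≤ 19 / 4 * R ^ 2 := by nlinarith
    calc |D - R| * (D ^ 2 + D * R + R ^ 2) ≤ 1 * (19 / 4 * R ^ 2) := by gcongr
      _ = 19 / 4 * R ^ 2 := one_mul _
  have h2 : (R / 2) ^ 3 * R ^ 3 ≤ D ^ 3 * R ^ 3 := by gcongr
  rw [e, abs_div, abs_of_pos (by positivity : 0 < D ^ 3 * R ^ 3)]
  calc _ ≤ 19 / 4 * R ^ 2 / ((R / 2) ^ 3 * R ^ 3) := by gcongr
    _ = 38 / R ^ 4 := by field_simp; norm_num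

/-- Far away, the rescaled attraction of the circle is close to that of a point mass. -/
lemma far_estimate {d r : ℝ} (hd : 4 ≤ d) (hr : r ∈ Icc (1 / 2 : ℝ) 2) (θ : ℝ) :
    |d ^ 2 / (2 * Real.pi) * (d * r) * polarCube 0 d r θ + -(r ^ 0 / r ^ 2)| ≤ 304 / d ∧
      |d ^ 2 / (2 * Real.pi) * polarDefect 0 d r θ| ≤ 304 / d := by
  have hpi := Real.pi_pos
  obtain ⟨hr1, hr2⟩ := hr
  have hr0 : 0 < r := by linarith
  have hd0 : 0 < d := by linarith
  set R := d * r with hR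
  have hR2 : 2 ≤ R := by rw [hR]; nlinarith
  have hR0 : 0 < R := by linarith
  set w : ℝ → ℝ := fun φ => (√(polarDistSq 0 d (r, θ, φ)) ^ 3)⁻¹ with hw
  have hclose : ∀ φ, |w φ - (R ^ 3)⁻¹| ≤ 38 / R ^ 4 := fun φ =>
    abs_inv_cube_sub_le hR2 (abs_sqrt_polarDistSq_sub_le (by linarith) θ φ)
  have hwc : Continuous w := by
    have hpos : ∀ φ, √(polarDistSq 0 d (r, θ, φ)) ^ 3 ≠ 0 := fun φ => by
      have := abs_le.1 (abs_sqrt_polarDistSq_sub_le (by linarith : 1 ≤ d * r) θ φ)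
      have : 0 < √(polarDistSq 0 d (r, θ, φ)) := by linarith
      positivity
    have : Continuous fun φ => polarDistSq 0 d (r, θ, φ) :=
      (contDiff_polarDistSq 0 d).continuous.comp (by fun_prop)
    simp only [hw]
    fun_prop (disch := assumption)
  have hbound : ∀ g : ℝ → ℝ, (∀ φ, |g φ| ≤ 38 / R ^ 4) →
      |∫ φ in (-Real.pi)..Real.pi, g φ| ≤ 38 / R ^ 4 * (2 * Real.pi) := by
    intro g hg
    have := intervalIntegral.norm_integral_le_of_norm_le_const (a := -Real.pi) (b := Real.pi)
      (f := g) (C := 38 / R ^ 4) fun φ _ => hg φ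
    rwa [abs_of_nonneg (by linarith), Real.norm_eq_abs,
      show Real.pi - -Real.pi = 2 * Real.pi by ring] at this
  have hA : |polarCube 0 d r θ - 2 * Real.pi * (R ^ 3)⁻¹| ≤ 38 / R ^ 4 * (2 * Real.pi) := by
    have e : polarCube 0 d r θ - 2 * Real.pi * (R ^ 3)⁻¹ =
        ∫ φ in (-Real.pi)..Real.pi, (w φ - (R ^ 3)⁻¹) := by
      rw [intervalIntegral.integral_sub (hwc.intervalIntegrable _ _) intervalIntegrable_const,
        intervalIntegral.integral_const, smul_eq_mul]
      rw [show Real.pi - -Real.pi = 2 * Real.pi by ring]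
      rfl
    rw [e]
    exact hbound _ hclose
  have hB : |polarDefect 0 d r θ| ≤ 38 / R ^ 4 * (2 * Real.pi) := by
    have e : polarDefect 0 d r θ = -∫ φ in (-Real.pi)..Real.pi, Real.cos φ * (w φ - (R ^ 3)⁻¹) := by
      simp only [mul_sub]
      rw [intervalIntegral.integral_sub
        (Continuous.intervalIntegrable (by fun_prop) _ _)
        (Continuous.intervalIntegrable (by fun_prop) _ _), intervalIntegral.integral_mul_const,
        integral_cos]
      simp only [Real.sin_pi, Real.sin_neg, neg_zero, sub_zero, zero_mul, polarDefect, zero_sub]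
      rfl
    rw [e, abs_neg]
    refine hbound _ fun φ => ?_
    rw [abs_mul]
    exact (mul_le_of_le_one_left (abs_nonneg _) (Real.abs_cos_le_one φ)).trans (hclose φ)
  have hr3 : 1 / 8 ≤ r ^ 3 := by
    calc (1 / 8 : ℝ) = (1 / 2) ^ 3 := by norm_num
      _ ≤ r ^ 3 := by gcongr
  have hfin : d ^ 2 / (2 * Real.pi) * R * (38 / R ^ 4 * (2 * Real.pi)) ≤ 304 / d := by
    have e : d ^ 2 / (2 * Real.pi) * R * (38 / R ^ 4 * (2 * Real.pi)) = 38 / r ^ 3 / d := by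
      rw [hR]; field_simp
    rw [e]
    gcongr
    rw [div_le_iff₀ (by positivity)]
    linarith
  have hk : 0 < d ^ 2 / (2 * Real.pi) := by positivity
  constructor
  · have e : d ^ 2 / (2 * Real.pi) * R * polarCube 0 d r θ + -(r ^ 0 / r ^ 2) =
        d ^ 2 / (2 * Real.pi) * R * (polarCube 0 d r θ - 2 * Real.pi * (R ^ 3)⁻¹) := by
      rw [mul_sub, sub_eq_add_neg]
      congr 2
      rw [hR]; field_simp
    rw [e, abs_mul, abs_of_pos (by positivity)]
    exact (mul_le_mul_of_nonneg_left hA (by positivity)).trans hfin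
  · rw [abs_mul, abs_of_pos hk]
    refine (mul_le_mul_of_nonneg_left hB hk.le).trans (le_trans ?_ hfin)
    gcongr
    exact le_mul_of_one_le_right hk.le (by linarith)

/-! ### The attraction near the circle -/

/-- The size of the correction to the attraction of a straight line, at the distance `h` from the
circle. -/
noncomputable def lineError (h : ℝ) : ℝ :=
  ∫ φ in (-Real.pi)..Real.pi, h / √(h ^ 2 + (1 - Real.cos φ))

lemma tendsto_lineError : Tendsto lineError (𝓝 0) (𝓝 0) := by
  have h0 : ∫ φ in (-Real.pi)..Real.pi, (0 : ℝ) = 0 := by simp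
  unfold lineError
  conv => rhs; rw [← h0]
  refine intervalIntegral.tendsto_integral_filter_of_dominated_convergence (fun _ => 1) ?_ ?_
    intervalIntegrable_const ?_
  · refine .of_forall fun h => Measurable.aestronglyMeasurable ?_
    fun_prop
  · refine .of_forall fun h => .of_forall fun φ _ => ?_
    rw [Real.norm_eq_abs, abs_div, abs_of_nonneg (Real.sqrt_nonneg _)]
    refine div_le_one_of_le₀ ?_ (Real.sqrt_nonneg _)
    apply Real.le_sqrt_of_sq_le
    rw [sq_abs]
    linarith [Real.cos_le_one φ]
  · have hne : ∀ᵐ φ : ℝ, φ ≠ 0 := by simp [ae_iff]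
    filter_upwards [hne] with φ hφ hφI
    rw [uIoc_of_le (by linarith [Real.pi_pos])] at hφI
    have hcos : Real.cos φ < 1 := by
      refine lt_of_le_of_ne (Real.cos_le_one φ) fun h => hφ ?_
      exact (Real.cos_eq_one_iff_of_lt_of_lt (by linarith [hφI.1, Real.pi_pos])
        (by linarith [hφI.2, Real.pi_pos])).1 h
    have hc : ContinuousAt (fun h : ℝ => h / √(h ^ 2 + (1 - Real.cos φ))) 0 := by
      refine ContinuousAt.div (by fun_prop) (by fun_prop) ?_
      have : 0 < 1 - Real.cos φ := by linarith
      positivity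
    simpa using hc.tendsto

lemma polarDistSq_one (d r θ φ : ℝ) : polarDistSq 1 d (r, θ, φ) =
    (d * r) ^ 2 + 2 * (1 + d * r * Real.cos θ) * (1 - Real.cos φ) := by
  have := Real.sin_sq_add_cos_sq θ
  simp only [polarDistSq, distSq]
  linear_combination (d * r) ^ 2 * this

/-- The integral of the inverse cubed distance from the circle, weighted by `cos (φ / 2)`. -/
lemma integral_cos_half_mul {h x : ℝ} (hh : 0 < h) (hx : 0 < x) :
    ∫ φ in (-Real.pi)..Real.pi,
      Real.cos (φ / 2) * (√(h ^ 2 + 2 * x * (1 - Real.cos φ)) ^ 3)⁻¹ =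
      4 / (h ^ 2 * √(h ^ 2 + 4 * x)) := by
  have hpos : ∀ φ, 0 < h ^ 2 + 2 * x * (1 - Real.cos φ) := fun φ => by
    have := mul_nonneg hx.le (sub_nonneg.2 (Real.cos_le_one φ))
    nlinarith [pow_pos hh 2]
  have hderiv : ∀ φ : ℝ, HasDerivAt
      (fun φ => 2 * Real.sin (φ / 2) / (h ^ 2 * √(h ^ 2 + 2 * x * (1 - Real.cos φ))))
      (Real.cos (φ / 2) * (√(h ^ 2 + 2 * x * (1 - Real.cos φ)) ^ 3)⁻¹) φ := by
    intro φ
    have hs : 0 < √(h ^ 2 + 2 * x * (1 - Real.cos φ)) := Real.sqrt_pos.2 (hpos φ)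
    have h1 := (((hasDerivAt_id φ).div_const 2).sin).const_mul 2
    have h2 := ((((Real.hasDerivAt_cos φ).const_sub 1).const_mul (2 * x)).const_add (h ^ 2)).sqrt
      (hpos φ).ne'
    refine (h1.div (h2.const_mul (h ^ 2)) (by positivity)).congr_deriv ?_
    have hsq := Real.sq_sqrt (hpos φ).le
    generalize √(h ^ 2 + 2 * x * (1 - Real.cos φ)) = D at hs hsq
    have e1 : Real.cos φ = 1 - 2 * Real.sin (φ / 2) ^ 2 := by
      rw [← mul_div_cancel₀ φ (two_ne_zero' ℝ), Real.cos_two_mul,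
        mul_div_cancel₀ φ (two_ne_zero' ℝ)]
      linarith [Real.sin_sq_add_cos_sq (φ / 2)]
    have e2 : Real.sin φ = 2 * Real.sin (φ / 2) * Real.cos (φ / 2) := by
      rw [← Real.sin_two_mul]; congr 1; ring
    rw [e1] at hsq
    simp only [id, e2]
    field_simp
    linear_combination Real.cos (φ / 2) * hsq
  have hcont : Continuous fun φ =>
      Real.cos (φ / 2) * (√(h ^ 2 + 2 * x * (1 - Real.cos φ)) ^ 3)⁻¹ := by
    have : ∀ φ, √(h ^ 2 + 2 * x * (1 - Real.cos φ)) ^ 3 ≠ 0 := fun φ => by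
      have := hpos φ
      positivity
    fun_prop (disch := assumption)
  rw [intervalIntegral.integral_eq_sub_of_hasDerivAt (fun φ _ => hderiv φ)
    (hcont.intervalIntegrable _ _)]
  rw [neg_div, Real.cos_neg, Real.sin_neg, Real.cos_pi, Real.sin_pi_div_two,
    show h ^ 2 + 2 * x * (1 - -1) = h ^ 2 + 4 * x by ring]
  ring

/-- Near the circle, the rescaled attraction of the circle is close to that of a straight line. -/
lemma near_estimate {d r : ℝ} (hd : 0 < d) (hdr : d * r ≤ 1 / 2) (hr : r ∈ Icc (1 / 2 : ℝ) 2)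
    (θ : ℝ) :
    |d / 2 * (d * r) * polarCube 1 d r θ + -(r ^ 1 / r ^ 2)| ≤
        4 * (d * r) + lineError (d * r) ∧
      |d / 2 * polarDefect 1 d r θ| ≤ lineError (d * r) := by
  have hpi := Real.pi_pos
  obtain ⟨hr1, hr2⟩ := hr
  have hr0 : 0 < r := by linarith
  set h := d * r with hh
  have hh0 : 0 < h := by positivity
  set x := 1 + h * Real.cos θ with hx
  have hx1 : 1 - h ≤ x := by nlinarith [Real.neg_one_le_cos θ]
  have hx2 : x ≤ 1 + h := by nlinarith [Real.cos_le_one θ]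
  set Q : ℝ → ℝ := fun φ => h ^ 2 + 2 * x * (1 - Real.cos φ) with hQ
  have hcos : ∀ φ, 0 ≤ 1 - Real.cos φ := fun φ => sub_nonneg.2 (Real.cos_le_one φ)
  have hQle : ∀ φ, h ^ 2 + (1 - Real.cos φ) ≤ Q φ := fun φ => by
    simp only [hQ]; nlinarith [hcos φ]
  have hEpos : ∀ φ, 0 < h ^ 2 + (1 - Real.cos φ) := fun φ => by
    have := hcos φ; positivity
  have hQpos : ∀ φ, 0 < Q φ := fun φ => (hEpos φ).trans_le (hQle φ)
  have hQs : ∀ φ, √(Q φ) ≠ 0 := fun φ => (Real.sqrt_pos.2 (hQpos φ)).ne'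
  have hQs3 : ∀ φ, √(Q φ) ^ 3 ≠ 0 := fun φ => pow_ne_zero _ (hQs φ)
  have hQc : Continuous Q := by fun_prop
  have hEs : ∀ φ, √(h ^ 2 + (1 - Real.cos φ)) ≠ 0 := fun φ => (Real.sqrt_pos.2 (hEpos φ)).ne'
  have hwc : Continuous fun φ => (√(Q φ) ^ 3)⁻¹ := by fun_prop (disch := assumption)
  -- The weight `1 - cos φ` removes the singularity of the inverse cubed distance.
  have hle : ∀ φ, (1 - Real.cos φ) * (√(Q φ) ^ 3)⁻¹ ≤ h⁻¹ * (h / √(h ^ 2 + (1 - Real.cos φ))) := by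
    intro φ
    have hs := Real.sqrt_pos.2 (hQpos φ)
    have hE := Real.sqrt_pos.2 (hEpos φ)
    have h1 : 1 - Real.cos φ ≤ √(Q φ) ^ 2 := by
      rw [Real.sq_sqrt (hQpos φ).le]; nlinarith [hQle φ]
    calc (1 - Real.cos φ) * (√(Q φ) ^ 3)⁻¹ ≤ √(Q φ) ^ 2 * (√(Q φ) ^ 3)⁻¹ := by gcongr
      _ = (√(Q φ))⁻¹ := by field_simp
      _ ≤ (√(h ^ 2 + (1 - Real.cos φ)))⁻¹ := by gcongr; exact hQle φ
      _ = _ := by field_simp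
  have hEint : IntervalIntegrable (fun φ => h⁻¹ * (h / √(h ^ 2 + (1 - Real.cos φ)))) volume
      (-Real.pi) Real.pi := Continuous.intervalIntegrable (by fun_prop (disch := assumption)) _ _
  have hweight : ∀ g : ℝ → ℝ, Continuous g →
      (∀ φ ∈ Icc (-Real.pi) Real.pi, 0 ≤ g φ ∧ g φ ≤ 1 - Real.cos φ) →
      0 ≤ ∫ φ in (-Real.pi)..Real.pi, g φ * (√(Q φ) ^ 3)⁻¹ ∧
        ∫ φ in (-Real.pi)..Real.pi, g φ * (√(Q φ) ^ 3)⁻¹ ≤ h⁻¹ * lineError h := by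
    intro g hg hgb
    constructor
    · exact intervalIntegral.integral_nonneg (by linarith) fun φ hφ =>
        mul_nonneg (hgb φ hφ).1 (by positivity)
    · rw [lineError, ← intervalIntegral.integral_const_mul]
      refine intervalIntegral.integral_mono_on (by linarith)
        ((hg.mul hwc).intervalIntegrable _ _) hEint fun φ hφ => le_trans ?_ (hle φ)
      exact mul_le_mul_of_nonneg_right (hgb φ hφ).2 (by positivity)
  have hA : polarCube 1 d r θ = ∫ φ in (-Real.pi)..Real.pi, (√(Q φ) ^ 3)⁻¹ := by
    refine intervalIntegral.integral_congr fun φ _ => ?_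
    have := polarDistSq_one d r θ φ
    simp only [polarDistSq] at this
    simp only [this, hQ, hx, hh]
  have hdefect : polarDefect 1 d r θ =
      ∫ φ in (-Real.pi)..Real.pi, (1 - Real.cos φ) * (√(Q φ) ^ 3)⁻¹ := by
    simp only [sub_mul, one_mul]
    rw [intervalIntegral.integral_sub (Continuous.intervalIntegrable (by fun_prop) _ _)
      (Continuous.intervalIntegrable (by fun_prop) _ _), polarDefect, ← hA, one_mul]
    congr 1
    refine intervalIntegral.integral_congr fun φ _ => ?_
    have := polarDistSq_one d r θ φ
    simp only [polarDistSq] at this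
    simp only [this, hQ, hx, hh]
  have hσ : 0 ≤ lineError h :=
    intervalIntegral.integral_nonneg (by linarith) fun φ _ => by positivity
  have hdh : d = h / r := by rw [hh]; field_simp
  have hrinv : 1 / r ≤ 2 := by rw [div_le_iff₀ hr0]; linarith
  constructor
  · have hsplit : polarCube 1 d r θ = 4 / (h ^ 2 * √(h ^ 2 + 4 * x)) +
        ∫ φ in (-Real.pi)..Real.pi, (1 - Real.cos (φ / 2)) * (√(Q φ) ^ 3)⁻¹ := by
      rw [← integral_cos_half_mul hh0 (by linarith), ← intervalIntegral.integral_add, hA]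
      · refine intervalIntegral.integral_congr fun φ _ => ?_
        simp only [hQ]; ring
      · exact Continuous.intervalIntegrable (by fun_prop (disch := assumption)) _ _
      · exact Continuous.intervalIntegrable (by fun_prop) _ _
    obtain ⟨h1, h2⟩ := hweight (fun φ => 1 - Real.cos (φ / 2)) (by fun_prop) fun φ hφ => by
      have hc : 0 ≤ Real.cos (φ / 2) := Real.cos_nonneg_of_mem_Icc
        ⟨by linarith [hφ.1], by linarith [hφ.2]⟩
      have hc1 := Real.cos_le_one (φ / 2)
      have e : Real.cos φ = 2 * Real.cos (φ / 2) ^ 2 - 1 := by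
        rw [← Real.cos_two_mul]; congr 1; ring
      rw [e]
      constructor <;> nlinarith
    set I := ∫ φ in (-Real.pi)..Real.pi, (1 - Real.cos (φ / 2)) * (√(Q φ) ^ 3)⁻¹
    have hs1 : 1 ≤ √(h ^ 2 + 4 * x) := Real.le_sqrt_of_sq_le (by nlinarith)
    have hs2 := Real.sq_sqrt (by nlinarith : 0 ≤ h ^ 2 + 4 * x)
    set s := √(h ^ 2 + 4 * x)
    have hI : |h ^ 2 * I| ≤ h * lineError h := by
      rw [abs_of_nonneg (by positivity)]
      calc h ^ 2 * I ≤ h ^ 2 * (h⁻¹ * lineError h) := by gcongr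
        _ = h * lineError h := by field_simp
    have hs3 : |2 / s - 1| ≤ 5 / 3 * h := by
      have e : 2 / s - 1 = (4 - s ^ 2) / (s * (2 + s)) := by field_simp; ring
      rw [e, abs_div, abs_of_pos (by positivity : 0 < s * (2 + s)), div_le_iff₀ (by positivity),
        hs2]
      have h3 : |4 - (h ^ 2 + 4 * x)| ≤ 5 * h := abs_le.2 ⟨by nlinarith, by nlinarith⟩
      nlinarith
    have e : d / 2 * h * polarCube 1 d r θ + -(r ^ 1 / r ^ 2) =
        1 / r * ((2 / s - 1) + h ^ 2 * I / 2) := by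
      rw [hsplit, hdh]; field_simp; ring
    rw [e, abs_mul, abs_of_pos (by positivity : 0 < 1 / r)]
    have h4 : |(2 / s - 1) + h ^ 2 * I / 2| ≤ 5 / 3 * h + h * lineError h / 2 := by
      refine (abs_add_le _ _).trans ?_
      rw [abs_div, abs_two]
      gcongr
    calc 1 / r * |(2 / s - 1) + h ^ 2 * I / 2| ≤ 2 * (5 / 3 * h + h * lineError h / 2) := by gcongr
      _ ≤ 4 * h + lineError h := by nlinarith
  · obtain ⟨h1, h2⟩ := hweight (fun φ => 1 - Real.cos φ) (by fun_prop) fun φ _ => ⟨hcos φ, le_rfl⟩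
    rw [hdefect, abs_of_nonneg (by positivity), hdh]
    calc h / r / 2 * _ ≤ h / r / 2 * (h⁻¹ * lineError h) := by gcongr
      _ = 1 / r * lineError h / 2 := by field_simp
      _ ≤ 2 * lineError h / 2 := by gcongr
      _ = lineError h := by ring

/-! ### The periodic orbits -/

lemma planePoint_notMem_circle {α x z : ℝ} (h : ∀ φ, 0 < distSq x z φ) :
    planePoint α x z ∉ circle := by
  rintro ⟨β, hβ⟩
  have h1 := norm_planePoint_sub α x z (β - α)
  rw [sub_add_cancel, ← hβ, sub_self, norm_zero] at h1
  exact (Real.sqrt_pos.2 (h (β - α))).ne h1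

/-- A nearly radial rescaled attraction has a periodic orbit on a symmetric polar curve. -/
lemma exists_polarCurve_orbit {lam α c d τ κ Θ η : ℝ} (hd : 0 < d) (hτ : 0 < τ) {m : ℕ}
    (hm : m * (2 * Θ) = 2 * Real.pi)
    (hoff : ∀ q : ℝ × ℝ × ℝ, q.1 ∈ Icc (1 / 2 : ℝ) 2 → 0 < polarDistSq c d q)
    (hκ : lam * τ ^ 2 / d = κ) {f : ℝ → ℝ}
    (hη : ∀ Fr Ft, IsNearRadial Θ f η Fr Ft → ∃ r p L, IsPolarOrbit Fr Ft r p L ∧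
        ∀ θ, (r (-θ) = r θ ∧ L (-θ) = L θ) ∧ r (2 * Θ - θ) = r θ ∧ L (2 * Θ - θ) = L θ)
    (hF : IsNearRadial Θ f η (radialForce c d κ) (transversalForce c d κ)) :
    ∃ r : ℝ → ℝ, Continuous r ∧ (∀ θ, r θ ∈ Icc (1 / 2 : ℝ) 2) ∧
      Function.Periodic r (2 * Real.pi) ∧ (∀ θ, r (-θ) = r θ) ∧ (∀ θ, r (2 * Θ - θ) = r θ) ∧
      ∃ s, IsPeriodicOrbit lam s ∧ range s = range (polarCurve α c d r) := by
  obtain ⟨r, p, L, horb, hsym⟩ := hη _ _ hF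
  have hper : ∀ g : ℝ → ℝ, (∀ θ, g (-θ) = g θ) → (∀ θ, g (2 * Θ - θ) = g θ) →
      Function.Periodic g (2 * Real.pi) := by
    intro g h1 h2
    rw [← hm]
    refine Function.Periodic.nat_mul (fun θ => ?_) m
    rw [← h2, show 2 * Θ - (θ + 2 * Θ) = -θ by ring, h1]
  have hr := hper r (fun θ => (hsym θ).1.1) fun θ => (hsym θ).2.1
  have hL := hper L (fun θ => (hsym θ).1.2) fun θ => (hsym θ).2.2
  have hrb : ∀ θ, r θ ∈ Icc (1 / 2 : ℝ) 2 := fun θ => (horb.mem θ).1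
  have hcurve : ∀ θ, polarCurve α c d r θ ∉ circle := fun θ =>
    planePoint_notMem_circle fun φ => hoff (r θ, θ, φ) (hrb θ)
  refine ⟨r, horb.continuous_r, hrb, hr, fun θ => (hsym θ).1.1, fun θ => (hsym θ).2.1,
    horb.exists_isPeriodicOrbit hr hL hτ hcurve fun θ => ?_⟩
  subst hκ
  exact neg_gradient_polarCurve hd.ne' hτ.ne' (hcurve θ)

lemma norm_planePoint (α x z : ℝ) : ‖planePoint α x z‖ = √(x ^ 2 + z ^ 2) := by
  rw [EuclideanSpace.norm_eq, Fin.sum_univ_three]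
  congr 1
  simp only [planePoint_eq, Real.norm_eq_abs, sq_abs]
  simp
  linear_combination x ^ 2 * Real.sin_sq_add_cos_sq α

lemma norm_polarCurve_sub {d : ℝ} (hd : 0 < d) {r : ℝ → ℝ} (hr : ∀ θ, 0 ≤ r θ) (α c θ : ℝ) :
    ‖polarCurve α c d r θ - planePoint α c 0‖ = d * r θ := by
  have h : polarCurve α c d r θ - planePoint α c 0 =
      planePoint α (d * (r θ * Real.cos θ)) (d * (r θ * Real.sin θ)) := by
    simp only [polarCurve, planePoint]; module
  rw [h, norm_planePoint, show (d * (r θ * Real.cos θ)) ^ 2 + (d * (r θ * Real.sin θ)) ^ 2 =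
    (d * r θ) ^ 2 by linear_combination (d * r θ) ^ 2 * Real.sin_sq_add_cos_sq θ]
  exact Real.sqrt_sq (mul_nonneg hd.le (hr θ))

lemma distSq_neg (x z φ : ℝ) : distSq (-x) z φ = distSq x z (φ + Real.pi) := by
  simp [distSq, Real.cos_add_pi]

lemma integral_add_pi {g : ℝ → ℝ} (hg : Function.Periodic g (2 * Real.pi)) :
    ∫ φ in (-Real.pi)..Real.pi, g (φ + Real.pi) = ∫ φ in (-Real.pi)..Real.pi, g φ := by
  rw [intervalIntegral.integral_comp_add_right]
  have := hg.intervalIntegral_add_eq 0 (-Real.pi)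
  rw [zero_add, show -Real.pi + 2 * Real.pi = Real.pi by ring] at this
  rw [← this]
  congr 1 <;> ring

lemma invCube_neg (x z : ℝ) : invCube (-x) z = invCube x z := by
  simp only [invCube, distSq_neg]
  exact integral_add_pi (g := fun φ => (√(distSq x z φ) ^ 3)⁻¹) fun φ => by simp [distSq]

lemma invCubeCos_neg (x z : ℝ) : invCubeCos (-x) z = -invCubeCos x z := by
  have h := integral_add_pi (g := fun φ => Real.cos φ * (√(distSq x z φ) ^ 3)⁻¹)
    fun φ => by simp [distSq]
  simp only [Real.cos_add_pi, neg_mul, intervalIntegral.integral_neg] at h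
  simp only [invCubeCos, distSq_neg]
  linarith

/-- The symmetry of the attraction under the reflection in the axis of the circle. -/
lemma force_pi_sub (d k r θ : ℝ) :
    radialForce 0 d k r (Real.pi - θ) = radialForce 0 d k r θ ∧
      transversalForce 0 d k r (Real.pi - θ) = -transversalForce 0 d k r θ := by
  simp only [radialForce, transversalForce, polarDefect, polarCube, Real.cos_pi_sub,
    Real.sin_pi_sub, zero_add, mul_neg, invCube_neg, invCubeCos_neg]
  constructor <;> ring

lemma force_two_pi_sub (c d k r θ : ℝ) :
    radialForce c d k r (2 * Real.pi - θ) = radialForce c d k r θ ∧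
      transversalForce c d k r (2 * Real.pi - θ) = -transversalForce c d k r θ := by
  simp [radialForce, transversalForce, polarDefect, polarCube, invCube, invCubeCos, distSq]

/-- Large periodic orbits, obtained from the circular orbits of the Kepler problem. -/
theorem exists_large_orbit {lam : ℝ} (hlam : 0 < lam) (ε : ℝ)
    {P : Submodule ℝ E3} (hP : IsVerticalPlane P) :
    ∃ s : ℝ → E3, IsPeriodicOrbit lam s ∧ (∀ t, s t ∈ P) ∧ (∀ t, 1 / ε ≤ ‖s t‖) ∧
      IsSimpleClosedCurve (range s) ∧ reflHorizontal '' range s = range s ∧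
      reflZAxis '' range s = range s ∧ Encloses P (range s) 0 := by
  have hpi := Real.pi_pos
  obtain ⟨α, hα⟩ := exists_circlePoint_mem hP
  have hPα := mem_iff_exists_planePoint hP hα
  obtain ⟨η, hη0, hη⟩ := exists_symmetric_polarOrbit (n := 0) (κ := 1) (Θ := Real.pi / 2)
    zero_le_one le_rfl (by simp) (by positivity) (by simp)
  obtain ⟨d, hd4, hdε, hdη⟩ : ∃ d : ℝ, 4 ≤ d ∧ 2 / ε ≤ d ∧ 608 / η ≤ d :=
    ⟨max 4 (max (2 / ε) (608 / η)), by simp, by simp, by simp⟩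
  have hd : 0 < d := by linarith
  have hoff : ∀ q : ℝ × ℝ × ℝ, q.1 ∈ Icc (1 / 2 : ℝ) 2 → 0 < polarDistSq 0 d q := by
    rintro ⟨r, θ, φ⟩ ⟨h1, h2⟩
    simp only at h1 h2
    have hdr : 2 ≤ d * r := by nlinarith
    have := abs_le.1 (abs_sqrt_polarDistSq_sub_le (by linarith : 1 ≤ d * r) θ φ)
    exact Real.sqrt_pos.1 (by linarith)
  have hsmall : 304 / d ≤ η / 2 := by
    rw [div_le_iff₀ hη0] at hdη
    rw [div_le_iff₀ hd]
    linarith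
  have hF : IsNearRadial (Real.pi / 2) (fun r => -(r ^ 0 / r ^ 2)) η
      (radialForce 0 d (d ^ 2 / (2 * Real.pi))) (transversalForce 0 d (d ^ 2 / (2 * Real.pi))) := by
    refine isNearRadial_of_near hoff (fun r hr θ => ?_) fun r θ => ?_
    · obtain ⟨h1, h2⟩ := far_estimate hd4 hr θ
      exact ⟨h1.trans hsmall, h2.trans hsmall⟩
    · rw [mul_div_cancel₀ _ (two_ne_zero' ℝ)]
      exact force_pi_sub _ _ _ _
  -- Kepler's third law for the total mass `2 * π * lam`.
  obtain ⟨r, hrc, hrb, hr, hr1, hr2, s, hs, hrange⟩ := exists_polarCurve_orbit (lam := lam) (α := α)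
    (τ := √(d ^ 3 / (2 * Real.pi * lam))) hd (by positivity) (m := 2) (by push_cast; ring) hoff
    (by rw [Real.sq_sqrt (by positivity)]; field_simp) hη hF
  have hr0 : ∀ θ, 0 < r θ := fun θ => by linarith [(hrb θ).1]
  have hmem : ∀ t, ∃ θ, polarCurve α 0 d r θ = s t := fun t => by
    have : s t ∈ range s := ⟨t, rfl⟩
    rwa [hrange] at this
  have hzero : planePoint α 0 0 = 0 := by simp [planePoint]
  refine ⟨s, hs, fun t => ?_, fun t => ?_, ?_⟩
  · obtain ⟨θ, hθ⟩ := hmem t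
    exact (hPα _).2 ⟨_, _, hθ.symm⟩
  · obtain ⟨θ, hθ⟩ := hmem t
    have h := norm_polarCurve_sub hd (fun θ => (hr0 θ).le) α 0 θ
    rw [hzero, sub_zero, hθ] at h
    rw [h]
    have : d * (1 / 2) ≤ d * r θ := by gcongr; exact (hrb θ).1
    have h2 : 2 / ε = 2 * (1 / ε) := by ring
    linarith
  · rw [hrange, ← hzero]
    exact ⟨isSimpleClosedCurve_polarCurve hd hrc hr0 hr, reflHorizontal_image_polarCurve hr1,
      reflZAxis_image_polarCurve fun θ => by
        have := hr2 θ
        rwa [mul_div_cancel₀ _ (two_ne_zero' ℝ)] at this,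
      encloses_polarCurve hd hrc hrb hr hPα⟩

/-- Small periodic orbits around a point of the circle, obtained from the circular orbits around an
attracting line. -/
theorem exists_small_orbit {lam : ℝ} (hlam : 0 < lam) {ε : ℝ} (hε : 0 < ε)
    {P : Submodule ℝ E3} (hP : IsVerticalPlane P) {p : E3} (hp : p ∈ circle ∩ (P : Set E3)) :
    ∃ s : ℝ → E3, IsPeriodicOrbit lam s ∧ (∀ t, s t ∈ P) ∧
      (∀ t, Metric.infDist (s t) circle ≤ ε) ∧ IsSimpleClosedCurve (range s) ∧
      reflHorizontal '' range s = range s ∧ Encloses P (range s) p := by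
  obtain ⟨⟨α, rfl⟩, hα⟩ := hp
  have hPα := mem_iff_exists_planePoint hP hα
  obtain ⟨η, hη0, hη⟩ := exists_symmetric_polarOrbit (n := 1) (κ := √2) (Θ := Real.pi)
    le_rfl (Real.one_le_sqrt.2 one_le_two) (by norm_num) Real.pi_pos (by
      intro h
      obtain ⟨k, hk⟩ := Real.sin_eq_zero_iff.1 h
      exact irrational_sqrt_two ⟨k, by simpa using mul_right_cancel₀ Real.pi_ne_zero hk⟩)
  obtain ⟨h₀, hh₀, herr⟩ : ∃ h₀ > 0, ∀ h : ℝ, 0 < h → h < h₀ → lineError h ≤ η / 4 := by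
    obtain ⟨h₀, hh₀, h⟩ := Metric.tendsto_nhds_nhds.1 tendsto_lineError (η / 4) (by positivity)
    refine ⟨h₀, hh₀, fun x hx hx' => ?_⟩
    have := h (x := x) (by rwa [Real.dist_eq, sub_zero, abs_of_pos hx])
    rw [Real.dist_eq, sub_zero] at this
    exact (le_abs_self _).trans this.le
  obtain ⟨d, hd, hd4, hdh, hdη, hdε⟩ :
      ∃ d : ℝ, 0 < d ∧ d ≤ 1 / 4 ∧ d ≤ h₀ / 4 ∧ d ≤ η / 64 ∧ d ≤ ε / 2 :=
    ⟨min (min (1 / 4) (h₀ / 4)) (min (η / 64) (ε / 2)), by positivity, by simp, by simp, by simp,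
      by simp⟩
  have hdr : ∀ r ∈ Icc (1 / 2 : ℝ) 2, 0 < d * r ∧ d * r ≤ 2 * d := fun r hr =>
    ⟨mul_pos hd (by linarith [hr.1]), by nlinarith [hr.2]⟩
  have hoff : ∀ q : ℝ × ℝ × ℝ, q.1 ∈ Icc (1 / 2 : ℝ) 2 → 0 < polarDistSq 1 d q := by
    rintro ⟨r, θ, φ⟩ hr
    obtain ⟨h1, h2⟩ := hdr r hr
    rw [polarDistSq_one]
    have h3 : 0 ≤ 1 + d * r * Real.cos θ := by nlinarith [Real.neg_one_le_cos θ]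
    have h4 := mul_nonneg h3 (sub_nonneg.2 (Real.cos_le_one φ))
    nlinarith [pow_pos h1 2]
  have hF : IsNearRadial Real.pi (fun r => -(r ^ 1 / r ^ 2)) η
      (radialForce 1 d (d / 2)) (transversalForce 1 d (d / 2)) := by
    refine isNearRadial_of_near hoff (fun r hr θ => ?_) fun r θ => force_two_pi_sub _ _ _ _ _
    obtain ⟨h1, h2⟩ := hdr r hr
    obtain ⟨h3, h4⟩ := near_estimate hd (by linarith) hr θ
    have h5 := herr (d * r) h1 (by linarith)
    exact ⟨h3.trans (by linarith), h4.trans (by linarith)⟩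
  -- The attraction of a line of density `lam` at the distance `h` is `2 * lam / h`.
  obtain ⟨r, hrc, hrb, hr, hr1, -, s, hs, hrange⟩ := exists_polarCurve_orbit (lam := lam) (α := α)
    (τ := √(d ^ 2 / (2 * lam))) hd (by positivity) (m := 1) (by simp) hoff
    (by rw [Real.sq_sqrt (by positivity)]; field_simp) hη hF
  have hr0 : ∀ θ, 0 < r θ := fun θ => by linarith [(hrb θ).1]
  have hmem : ∀ t, ∃ θ, polarCurve α 1 d r θ = s t := fun t => by
    have : s t ∈ range s := ⟨t, rfl⟩
    rwa [hrange] at this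
  have hone : planePoint α 1 0 = circlePoint α := by simp [planePoint]
  refine ⟨s, hs, fun t => ?_, fun t => ?_, ?_⟩
  · obtain ⟨θ, hθ⟩ := hmem t
    exact (hPα _).2 ⟨_, _, hθ.symm⟩
  · obtain ⟨θ, hθ⟩ := hmem t
    have h := norm_polarCurve_sub hd (fun θ => (hr0 θ).le) α 1 θ
    rw [hone, hθ, ← dist_eq_norm] at h
    refine (Metric.infDist_le_dist_of_mem (circlePoint_mem α)).trans ?_
    rw [h]
    linarith [(hdr _ (hrb θ)).2]
  · rw [hrange, ← hone]
    exact ⟨isSimpleClosedCurve_polarCurve hd hrc hr0 hr, reflHorizontal_image_polarCurve hr1,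
      encloses_polarCurve hd hrc hrb hr hPα⟩

end FixedCircle

theorem theoremA (lam : ℝ) (hlam : 0 < lam) (ε : ℝ) (hε : 0 < ε)
    (P : Submodule ℝ FixedCircle.E3) (hP : FixedCircle.IsVerticalPlane P) :
    (∃ r : ℝ → FixedCircle.E3,
      FixedCircle.IsPeriodicOrbit lam r ∧
      (∀ t, r t ∈ P) ∧
      (∀ t, 1 / ε ≤ ‖r t‖) ∧
      FixedCircle.IsSimpleClosedCurve (Set.range r) ∧
      FixedCircle.reflHorizontal '' Set.range r = Set.range r ∧
      FixedCircle.reflZAxis '' Set.range r = Set.range r ∧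
      FixedCircle.Encloses P (Set.range r) 0) ∧
    (∀ p ∈ FixedCircle.circle ∩ (P : Set FixedCircle.E3), ∃ s : ℝ → FixedCircle.E3,
      FixedCircle.IsPeriodicOrbit lam s ∧
      (∀ t, s t ∈ P) ∧
      (∀ t, Metric.infDist (s t) FixedCircle.circle ≤ ε) ∧
      FixedCircle.IsSimpleClosedCurve (Set.range s) ∧
      FixedCircle.reflHorizontal '' Set.range s = Set.range s ∧
      FixedCircle.Encloses P (Set.range s) p) := by
  refine ⟨FixedCircle.exists_large_orbit hlam ε hP, fun p hp => ?_⟩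
  exact FixedCircle.exists_small_orbit hlam hε hP hp
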